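/- **Conventions.** A bivariate copula is identified with its distribution function $C(u,v)$ on $(0,1)^2$, with $h^{(1)}(u,v)=\partial_u C(u,v)$, $h^{(2)}(u,v)=\partial_v C(u,v)$ and density $c=\partial_u\partial_v C$. Given a sequence $(C_k)_{k\ge1}$ of bivariate copulas with derivatives $h_k^{(1)},h_k^{(2)}$ and densities $c_k$, the forward and backward Rosenblatt functions $R^{(1)}_k,R^{(2)}_k:(0,1)^k\times(0,1)\to(0,1)$ are defined by $R^{(1)}_0(\cdot,x)=R^{(2)}_0(\cdot,x)=x$ and, for $k\ge1$ and $\boldsymbol u=(u_1,\dots,u_k)$, $$R^{(1)}_k(\boldsymbol u,x)=h^{(1)}_k\big(R^{(2)}_{k-1}(\boldsymbol u_{-1},u_1),R^{(1)}_{k-1}(\boldsymbol u_{-1},x)\big),\qquad R^{(2)}_k(\boldsymbol u,x)=h^{(2)}_k\big(R^{(2)}_{k-1}(\boldsymbol u_{-k},x),R^{(1)}_{k-1}(\boldsymbol u_{-k},u_k)\big),$$ where $\boldsymbol u_{-i}$ is $\boldsymbol u$ without its $i$th component. Write $R_k=R_k^{(1)}$, and let $R_k^{-1}(\boldsymbol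 u,\cdot)$ be the inverse of $x\mapsto R_k(\boldsymbol u,x)$ on $(0,1)$. The Rosenblatt inverse functions are given by $S_0(\cdot,x)=x$ and, for $k\ge1$, $$S_k(\boldsymbol z,x)=R_k^{-1}\big((z_1,S_1(z_1,z_2),\dots,S_{k-1}((z_1,\dots,z_{k-1}),z_k)),x\big).$$ An *s-vine copula process* with pair copulas $(C_k)_{k\ge1}$ is a strictly stationary process $(U_t)_{t\in\mathbb Z}$ of random variables that are uniform on $(0,1)$ such that for all $t\in\mathbb Z$ and $n\ge2$ the vector $(U_t,\dots,U_{t+n-1})$ has the joint density $$c_{(n)}(u_1,\dots,u_n)=\prod_{k=1}^{n-1}\prod_{j=k+1}^{n}c_k\big(R^{(2)}_{k-1}((u_{j-k+1},\dots,u_{j-1}),u_{j-k}),\,R^{(1)}_{k-1}((u_{j-k+1},\dots,u_{j-1}),u_j)\big)$$ on $(0,1)^n$. It is a *Gaussian* s-vine copula process with parameters $(\alpha_k)_{k\ge1}$, $\alpha_k\in(-1,1)$, if each $C_k$ is the Gaussian copula $C_k(u,v)=\Phi_{\alpha_k}(\Phi^{-1}(u),\Phi^{-1}(v))$, where $\Phi$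 is the standard normal distribution function and $\Phi_\rho$ is the distribution function of the centred bivariate normal law with unit variances and correlation $\rho$. **Theorem.** Let $(U_t)_{t\in\mathbb Z}$ be a Gaussian s-vine copula process whose parameters $(\alpha_k)_{k\ge1}$ satisfy $\sum_{k=1}^\infty|\alpha_k|<\infty$. Then there is, on the same probability space, a process $(Z_t)_{t\in\mathbb Z}$ of independent random variables uniform on $(0,1)$ such that, for every $t\in\mathbb Z$, almost surely $$U_t=\lim_{k\to\infty}S_k\big((Z_{t-k},\dots,Z_{t-1}),Z_t\big)\qquad\text{and}\qquad Z_t=\lim_{k\to\infty}R_k\big((U_{t-k},\dots,U_{t-1}),U_t\big).$$ That is, the process is strongly causal (first representation) and strongly invertible (second representation), with a common innovation process. -/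

import Mathlib

open MeasureTheory ProbabilityTheory Filter Topology Set

noncomputable section

namespace SVine

/-! ### Pair copulas: partial derivatives and density

A bivariate copula is represented by its distribution function `C : ℝ → ℝ → ℝ`; only its values on
the open unit square `(0,1)²` matter. -/

/-- `h⁽¹⁾(u,v) = ∂C(u,v)/∂u`. -/
def hFst (C : ℝ → ℝ → ℝ) (u v : ℝ) : ℝ := deriv (fun x => C x v) u

/-- `h⁽²⁾(u,v) = ∂C(u,v)/∂v`. -/
def hSnd (C : ℝ → ℝ → ℝ) (u v : ℝ) : ℝ := deriv (fun y => C u y) v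

/-- The copula density `c(u,v) = ∂²C(u,v)/∂u∂v`. -/
def pairDensity (C : ℝ → ℝ → ℝ) (u v : ℝ) : ℝ := deriv (fun y => hFst C u y) v

/-! ### Rosenblatt functions of a sequence of pair copulas

A sequence `(C_k)_{k ≥ 1}` of pair copulas is a function `C : ℕ → ℝ → ℝ → ℝ` whose value at `0` is
never used. A vector `(u_1, …, u_k)` is a function `Fin k → ℝ`, with `u_{i+1}` at position `i`. -/

/-- The pair `(R⁽¹⁾_k(u, x), R⁽²⁾_k(u, x))` of the forward and the backward Rosenblatt function,
defined by their interlacing recursion, with the convention `R⁽¹⁾_0(·, x) = R⁽²⁾_0(·, x) = x`.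
`Fin.tail u` is `u` without its first and `Fin.init u` is `u` without its last component. -/
def rosenblattPair (C : ℕ → ℝ → ℝ → ℝ) : (k : ℕ) → (Fin k → ℝ) → ℝ → ℝ × ℝ
  | 0, _, x => (x, x)
  | k + 1, u, x =>
    (hFst (C (k + 1)) (rosenblattPair C k (Fin.tail u) (u 0)).2
        (rosenblattPair C k (Fin.tail u) x).1,
      hSnd (C (k + 1)) (rosenblattPair C k (Fin.init u) x).2
        (rosenblattPair C k (Fin.init u) (u (Fin.last k))).1)

/-- The forward Rosenblatt function `R_k = R⁽¹⁾_k`. -/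
def rosenblatt (C : ℕ → ℝ → ℝ → ℝ) (k : ℕ) (u : Fin k → ℝ) (x : ℝ) : ℝ :=
  (rosenblattPair C k u x).1

/-- The backward Rosenblatt function `R⁽²⁾_k`. -/
def rosenblattBack (C : ℕ → ℝ → ℝ → ℝ) (k : ℕ) (u : Fin k → ℝ) (x : ℝ) : ℝ :=
  (rosenblattPair C k u x).2

/-- The inverse `R_k⁻¹(u, z)` of the forward Rosenblatt function in its last argument: the
`x ∈ (0,1)` with `R_k(u, x) = z`. -/
def rosenblattInv (C : ℕ → ℝ → ℝ → ℝ) (k : ℕ) (u : Fin k → ℝ) (z : ℝ) : ℝ :=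
  Function.invFunOn (fun x => rosenblatt C k u x) (Ioo 0 1) z

/-- The Rosenblatt inverse functions `S_k`, given by `S_0(·, x) = x` and
`S_k(z, x) = R_k⁻¹((z_1, S_1(z_1, z_2), …, S_{k-1}((z_1, …, z_{k-1}), z_k)), x)`. -/
def rosenblattS (C : ℕ → ℝ → ℝ → ℝ) : (k : ℕ) → (Fin k → ℝ) → ℝ → ℝ
  | 0, _, x => x
  | k + 1, z, x =>
    rosenblattInv C (k + 1)
      (fun i : Fin (k + 1) =>
        rosenblattS C i.val (fun j : Fin i.val => z ⟨j.val, j.isLt.trans i.isLt⟩) (z i)) x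
termination_by k => k

/-! ### S-vine copula processes -/

/-- The s-vine density `c_(n)(u_1, …, u_n)`: the product over the lags `k + 1 = 1, …, n - 1` and over
the positions `i` of the left end of all factors `c_{k+1}(R⁽²⁾_k(w, u_i), R⁽¹⁾_k(w, u_{i+k+1}))`,
where `w = (u_{i+1}, …, u_{i+k})` consists of the variables in between. -/
def svineDensity (C : ℕ → ℝ → ℝ → ℝ) (n : ℕ) (u : Fin n → ℝ) : ℝ :=
  ∏ k : Fin (n - 1), ∏ i : Fin (n - 1 - k.val),
    pairDensity (C (k.val + 1))
      (rosenblattBack C k.val (fun m : Fin k.val => u ⟨i.val + 1 + m.val, by omega⟩)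
        (u ⟨i.val, by omega⟩))
      (rosenblatt C k.val (fun m : Fin k.val => u ⟨i.val + 1 + m.val, by omega⟩)
        (u ⟨i.val + k.val + 1, by omega⟩))

variable {Ω : Type*} [MeasurableSpace Ω]

/-- `(U_t)_{t ∈ ℤ}` is an s-vine copula process with pair copulas `(C_k)_{k ≥ 1}`: a strictly
stationary process with standard uniform margins such that, for every `t` and every `n ≥ 2`, the
vector `(U_t, …, U_{t+n-1})` is absolutely continuous and its copula, which is its distribution
function as the margins are uniform, has the density `c_(n)`. -/
structure IsSVineCopulaProcess (C : ℕ → ℝ → ℝ → ℝ) (U : ℤ → Ω → ℝ) (μ : Measure Ω) : Prop where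
  measurable : ∀ t, Measurable (U t)
  stationary : ∀ h : ℤ, IdentDistrib (fun ω t => U (t + h) ω) (fun ω t => U t ω) μ μ
  uniform : ∀ t, pdf.IsUniform (U t) (Ioo 0 1) μ
  density : ∀ (t : ℤ) (n : ℕ), 2 ≤ n →
    μ.map (fun ω (i : Fin n) => U (t + (i.val : ℤ)) ω) =
      ((volume : Measure (Fin n → ℝ)).restrict (univ.pi fun _ => Ioo 0 1)).withDensity
        (fun u => ENNReal.ofReal (svineDensity C n u))

/-- `(Z_t)_{t ∈ ℤ}` is a process of independent standard uniform random variables. -/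
structure IsIIDUniform (Z : ℤ → Ω → ℝ) (μ : Measure Ω) : Prop where
  measurable : ∀ t, Measurable (Z t)
  indep : iIndepFun Z μ
  uniform : ∀ t, pdf.IsUniform (Z t) (Ioo 0 1) μ

/-- The vector `(Y_{t-k}, …, Y_{t-1})` of the `k` values before time `t`. -/
def pastWindow (Y : ℤ → Ω → ℝ) (t : ℤ) (k : ℕ) (ω : Ω) : Fin k → ℝ :=
  fun i => Y (t - (k : ℤ) + (i.val : ℤ)) ω

/-- For all `t`, `U_t = lim_{k → ∞} S_k((Z_{t-k}, …, Z_{t-1}), Z_t)` almost surely. -/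
def HasCausalRepresentation (C : ℕ → ℝ → ℝ → ℝ) (U Z : ℤ → Ω → ℝ) (μ : Measure Ω) : Prop :=
  ∀ t, ∀ᵐ ω ∂μ,
    Tendsto (fun k : ℕ => rosenblattS C k (pastWindow Z t k ω) (Z t ω)) atTop (𝓝 (U t ω))

/-- For all `t`, `Z_t = lim_{k → ∞} R_k((U_{t-k}, …, U_{t-1}), U_t)` almost surely. -/
def HasInvertibleRepresentation (C : ℕ → ℝ → ℝ → ℝ) (U Z : ℤ → Ω → ℝ) (μ : Measure Ω) : Prop :=
  ∀ t, ∀ᵐ ω ∂μ,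
    Tendsto (fun k : ℕ => rosenblatt C k (pastWindow U t k ω) (U t ω)) atTop (𝓝 (Z t ω))

/-! ### Gaussian pair copulas -/

/-- The standard normal quantile function `Φ⁻¹`. -/
def normalQuantile (u : ℝ) : ℝ := sInf {x : ℝ | u ≤ cdf (gaussianReal 0 1) x}

/-- The Gaussian copula `C^Ga_ρ(u,v) = Φ_ρ(Φ⁻¹(u), Φ⁻¹(v))`, where `Φ_ρ` is the distribution
function of the centred bivariate normal law with unit variances and correlation `ρ`. -/
def gaussianCopula (ρ u v : ℝ) : ℝ :=
  (multivariateGaussian (0 : EuclideanSpace ℝ (Fin 2)) !![1, ρ; ρ, 1]).real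
    {x | x 0 ≤ normalQuantile u ∧ x 1 ≤ normalQuantile v}

end SVine

end

/-! Write X_t = Φ⁻¹(U_t). In normal scale the h-function of a Gaussian copula is (y - ρx)/√(1 - ρ²),
so the Rosenblatt recursion turns into the Levinson–Durbin recursion (`rosenblatt_gaussian`): R_k of
the past and U_t is Φ(e_k(t)), where e_k(t) is the normalized error of predicting X_t from its k
predecessors. It is obtained by applying a polynomial p_k in the backward shift to X. The s-vine
density, written in these coordinates, says that e_0(a), e_1(a+1), e_2(a+2), … are independent
standard normal for every starting time a (`map_predMatrix_svine`).

Invertibility. The ℓ¹ norm of p_{k+1} - p_k is O(|α_{k+1}|), hence summable, and the e_k(t) converge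
almost surely to innovations ε_t. Errors whose windows start at a common time are independent;
letting that time tend to -∞ makes the ε_t independent standard normal, and Z_t = Φ(ε_t).

Causality. S_k solves by forward substitution the triangular system whose right-hand side is the ε
on the window t-k, …, t, whereas X solves it with the finite-order errors. The two solutions at time
t differ by ∑_{j≤k} E[X_t e_{k-j}(t-j)] (ε_{t-j} - e_{k-j}(t-j)). Each term vanishes as k → ∞, and
dominated convergence applies once the covariances have a majorant Ψ_j that is summable and free of
k (`exists_summable_bound_pairing_predPoly`).

The majorant rests on Baxter's theorem, that the autocovariances γ are absolutely summable. It is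
proved inside the Laurent polynomials, with p* the reflection of p. As multipliers on ℓ², the p_m
p_m* lie between 1/B and B, so N_m = 1 - p_m p_m*/B contracts ℓ². Finite supports and Cauchy–Schwarz
turn this into geometric ℓ¹ decay of the powers of one N_M, and a perturbation argument makes the
decay uniform in m ≥ M (`exists_coeffNorm_defect_pow_le`). Partial geometric sums of N_m are then
bounded in ℓ¹ and, up to the factor 1/B and vanishing errors, have the γ_j as coefficients. -/

noncomputable section

namespace SVine

open LaurentPolynomial

/-! ### Laurent polynomials as finitely supported sequences -/

/-- The pairing `∑ f_j x_j` of a Laurent polynomial with a two-sided sequence. -/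
def pairing (x : ℤ → ℝ) : ℝ[T;T⁻¹] →ₗ[ℝ] ℝ :=
  (Finsupp.linearCombination ℝ x).comp (AddMonoidAlgebra.coeffLinearEquiv ℝ).toLinearMap

lemma pairing_apply (x : ℤ → ℝ) (f : ℝ[T;T⁻¹]) :
    pairing x f = ∑ j ∈ f.coeff.support, f.coeff j * x j := by
  simp [pairing, Finsupp.linearCombination_apply, Finsupp.sum]

lemma pairing_C_mul (x : ℤ → ℝ) (a : ℝ) (f : ℝ[T;T⁻¹]) :
    pairing x (C a * f) = a * pairing x f := by
  rw [← smul_eq_C_mul, map_smul, smul_eq_mul]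

lemma pairing_T (x : ℤ → ℝ) (n : ℤ) : pairing x (T n) = x n := by
  simp [pairing, T, -single_eq_C_mul_T]

lemma pairing_one (x : ℤ → ℝ) : pairing x 1 = x 0 := by
  rw [← T_zero, pairing_T]

lemma pairing_T_mul (x : ℤ → ℝ) (n : ℤ) (f : ℝ[T;T⁻¹]) :
    pairing x (T n * f) = pairing (fun j => x (n + j)) f := by
  induction f using LaurentPolynomial.induction_on' with
  | add p q hp hq => rw [mul_add, map_add, map_add, hp, hq]
  | C_mul_T m a =>
    rw [mul_left_comm, ← T_add, pairing_C_mul, pairing_C_mul, pairing_T, pairing_T]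

lemma pairing_eq_sum (x : ℤ → ℝ) (f : ℝ[T;T⁻¹]) {s : Finset ℤ} (hs : f.coeff.support ⊆ s) :
    pairing x f = ∑ j ∈ s, f.coeff j * x j := by
  rw [pairing_apply]
  refine Finset.sum_subset hs fun j _ hj => ?_
  rw [Finsupp.notMem_support_iff.1 hj, zero_mul]

lemma coeff_T_mul (n : ℤ) (f : ℝ[T;T⁻¹]) (j : ℤ) : (T n * f).coeff j = f.coeff (j - n) := by
  rw [T, AddMonoidAlgebra.coeff_single_mul_eq_mul_coeff (m₂ := j - n), one_mul]
  intro m _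
  omega

lemma coeff_C_mul (a : ℝ) (f : ℝ[T;T⁻¹]) (j : ℤ) : (C a * f).coeff j = a * f.coeff j := by
  rw [← smul_eq_C_mul]; simp

lemma eq_sum_C_mul_T (f : ℝ[T;T⁻¹]) : f = ∑ j ∈ f.coeff.support, C (f.coeff j) * T j := by
  ext i
  simp only [AddMonoidAlgebra.coeff_sum, Finsupp.finsetSum_apply, coeff_C_mul, T_apply]
  simp [eq_comm]

/-- The `ℓ¹` norm of the coefficients. -/
def coeffNorm (f : ℝ[T;T⁻¹]) : ℝ := ∑ j ∈ f.coeff.support, |f.coeff j|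

lemma coeffNorm_nonneg (f : ℝ[T;T⁻¹]) : 0 ≤ coeffNorm f :=
  Finset.sum_nonneg fun _ _ => abs_nonneg _

lemma coeffNorm_eq_sum (f : ℝ[T;T⁻¹]) {s : Finset ℤ} (hs : f.coeff.support ⊆ s) :
    coeffNorm f = ∑ j ∈ s, |f.coeff j| := by
  refine Finset.sum_subset hs fun j _ hj => ?_
  rw [Finsupp.notMem_support_iff.1 hj, abs_zero]

lemma sum_abs_coeff_le (f : ℝ[T;T⁻¹]) (s : Finset ℤ) : ∑ j ∈ s, |f.coeff j| ≤ coeffNorm f := by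
  classical
  rw [coeffNorm_eq_sum f (Finset.subset_union_left (s₂ := s))]
  exact Finset.sum_le_sum_of_subset_of_nonneg Finset.subset_union_right
    fun _ _ _ => abs_nonneg _

lemma coeffNorm_add_le (f g : ℝ[T;T⁻¹]) : coeffNorm (f + g) ≤ coeffNorm f + coeffNorm g := by
  classical
  rw [coeffNorm_eq_sum f (Finset.subset_union_left (s₂ := g.coeff.support)),
    coeffNorm_eq_sum g (Finset.subset_union_right (s₁ := f.coeff.support)),
    coeffNorm_eq_sum (f + g) (Finsupp.support_add (g₁ := f.coeff) (g₂ := g.coeff)),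
    ← Finset.sum_add_distrib]
  exact Finset.sum_le_sum fun j _ => by simpa using abs_add_le (f.coeff j) (g.coeff j)

lemma coeffNorm_zero : coeffNorm 0 = 0 := by simp [coeffNorm]

lemma coeffNorm_sum_le {ι : Type*} (s : Finset ι) (f : ι → ℝ[T;T⁻¹]) :
    coeffNorm (∑ i ∈ s, f i) ≤ ∑ i ∈ s, coeffNorm (f i) := by
  classical
  induction s using Finset.induction_on with
  | empty => simp [coeffNorm_zero]
  | insert a s ha ih =>
    rw [Finset.sum_insert ha, Finset.sum_insert ha]
    exact (coeffNorm_add_le _ _).trans (by gcongr)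

lemma coeffNorm_C_mul (a : ℝ) (f : ℝ[T;T⁻¹]) : coeffNorm (C a * f) = |a| * coeffNorm f := by
  have h : (C a * f).coeff.support ⊆ f.coeff.support := by
    intro j hj
    rw [Finsupp.mem_support_iff, coeff_C_mul] at hj
    exact Finsupp.mem_support_iff.2 (right_ne_zero_of_mul hj)
  rw [coeffNorm_eq_sum _ h, coeffNorm, Finset.mul_sum]
  exact Finset.sum_congr rfl fun j _ => by rw [coeff_C_mul, abs_mul]

lemma coeffNorm_T_mul (n : ℤ) (f : ℝ[T;T⁻¹]) : coeffNorm (T n * f) = coeffNorm f := by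
  have h : (T n * f).coeff.support ⊆ f.coeff.support.map (Equiv.addRight n).toEmbedding := by
    intro j hj
    rw [Finsupp.mem_support_iff, coeff_T_mul] at hj
    exact Finset.mem_map.2 ⟨j - n, Finsupp.mem_support_iff.2 hj, by simp⟩
  rw [coeffNorm_eq_sum _ h, Finset.sum_map, coeffNorm]
  exact Finset.sum_congr rfl fun j _ => by rw [coeff_T_mul]; simp

lemma coeffNorm_one : coeffNorm 1 = 1 := by
  rw [coeffNorm_eq_sum (s := {0})]
  · rw [← T_zero]; simp
  · intro j hj
    rw [Finsupp.mem_support_iff, ← T_zero, T_apply] at hj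
    simp at hj ⊢
    exact hj.symm

lemma coeffNorm_mul_le (f g : ℝ[T;T⁻¹]) : coeffNorm (f * g) ≤ coeffNorm f * coeffNorm g := by
  conv_lhs => rw [eq_sum_C_mul_T f]
  have h : coeffNorm f * coeffNorm g = ∑ j ∈ f.coeff.support, |f.coeff j| * coeffNorm g :=
    Finset.sum_mul _ _ _
  rw [Finset.sum_mul, h]
  refine (coeffNorm_sum_le _ _).trans (Finset.sum_le_sum fun j _ => ?_)
  rw [mul_assoc, coeffNorm_C_mul, coeffNorm_T_mul]

lemma coeffNorm_neg (f : ℝ[T;T⁻¹]) : coeffNorm (-f) = coeffNorm f := by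
  simp [coeffNorm]

lemma coeffNorm_sub_le (f g : ℝ[T;T⁻¹]) : coeffNorm (f - g) ≤ coeffNorm f + coeffNorm g := by
  rw [sub_eq_add_neg, ← coeffNorm_neg g]
  exact coeffNorm_add_le _ _

lemma coeffNorm_pow_le (f : ℝ[T;T⁻¹]) (n : ℕ) : coeffNorm (f ^ n) ≤ coeffNorm f ^ n := by
  induction n with
  | zero => simp [coeffNorm_one]
  | succ n ih =>
    rw [pow_succ, pow_succ]
    exact (coeffNorm_mul_le _ _).trans (by gcongr; exact coeffNorm_nonneg _)

lemma coeffNorm_invert (f : ℝ[T;T⁻¹]) : coeffNorm (invert f) = coeffNorm f := by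
  have h : (invert f).coeff.support ⊆ f.coeff.support.map (Equiv.neg ℤ).toEmbedding := by
    intro j hj
    rw [Finsupp.mem_support_iff, invert_apply] at hj
    exact Finset.mem_map.2 ⟨-j, Finsupp.mem_support_iff.2 hj, by simp⟩
  rw [coeffNorm_eq_sum _ h, Finset.sum_map, coeffNorm]
  exact Finset.sum_congr rfl fun j _ => by simp

lemma abs_pairing_le {x : ℤ → ℝ} {b : ℝ} (hx : ∀ j, |x j| ≤ b) (f : ℝ[T;T⁻¹]) :
    |pairing x f| ≤ coeffNorm f * b := by
  rw [pairing_apply, coeffNorm, Finset.sum_mul]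
  refine (Finset.abs_sum_le_sum_abs _ _).trans (Finset.sum_le_sum fun j _ => ?_)
  rw [abs_mul]
  exact mul_le_mul_of_nonneg_left (hx j) (abs_nonneg _)

/-- The `ℓ²` inner product of the coefficients. -/
def coeffInner (f g : ℝ[T;T⁻¹]) : ℝ := (f * invert g).coeff 0

lemma coeffInner_eq (f g : ℝ[T;T⁻¹]) :
    coeffInner f g = ∑ j ∈ f.coeff.support, f.coeff j * g.coeff j := by
  rw [coeffInner]
  conv_lhs => rw [eq_sum_C_mul_T f]
  simp only [Finset.sum_mul, AddMonoidAlgebra.coeff_sum, Finsupp.finsetSum_apply, mul_assoc,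
    coeff_C_mul, coeff_T_mul, invert_apply]
  simp

lemma coeffInner_self (f : ℝ[T;T⁻¹]) :
    coeffInner f f = ∑ j ∈ f.coeff.support, f.coeff j ^ 2 := by
  rw [coeffInner_eq]
  exact Finset.sum_congr rfl fun _ _ => (sq _).symm

lemma coeffInner_self_nonneg (f : ℝ[T;T⁻¹]) : 0 ≤ coeffInner f f := by
  rw [coeffInner_self]
  exact Finset.sum_nonneg fun _ _ => sq_nonneg _

lemma coeffInner_comm (f g : ℝ[T;T⁻¹]) : coeffInner f g = coeffInner g f := by
  have h : g * invert f = invert (f * invert g) := by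
    rw [map_mul, involutive_invert g, mul_comm]
  rw [coeffInner, coeffInner, h, invert_apply, neg_zero]

lemma coeffInner_C_mul_add (a b : ℝ) (f g : ℝ[T;T⁻¹]) :
    coeffInner (C a * f + C b * g) (C a * f + C b * g) =
      a ^ 2 * coeffInner f f + 2 * a * b * coeffInner f g + b ^ 2 * coeffInner g g := by
  have h : (C a * f + C b * g) * invert (C a * f + C b * g) =
      C (a ^ 2) * (f * invert f) + C (a * b) * (f * invert g) + C (a * b) * (g * invert f) +
        C (b ^ 2) * (g * invert g) := by
    simp only [map_add, map_mul, invert_C, map_pow]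
    ring
  have h2 := coeffInner_comm f g
  simp only [coeffInner] at h2 ⊢
  rw [h]
  simp only [AddMonoidAlgebra.coeff_add, Finsupp.add_apply, coeff_C_mul]
  rw [← h2]
  ring

lemma coeffInner_T_mul (n : ℤ) (f : ℝ[T;T⁻¹]) :
    coeffInner (T n * f) (T n * f) = coeffInner f f := by
  have h : T n * f * invert (T n * f) = f * invert f := by
    rw [map_mul, invert_T]
    calc T n * f * (T (-n) * invert f) = (T n * T (-n)) * (f * invert f) := by ring
      _ = f * invert f := by rw [← T_add]; simp
  rw [coeffInner, h, coeffInner]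

/-- Cauchy–Schwarz. This is the passage from ℓ² to ℓ¹, and it costs the size of the support. -/
lemma coeffNorm_sq_le (f : ℝ[T;T⁻¹]) :
    coeffNorm f ^ 2 ≤ f.coeff.support.card * coeffInner f f := by
  rw [coeffNorm, coeffInner_self]
  refine (sq_sum_le_card_mul_sum_sq).trans (le_of_eq ?_)
  simp

section

/-! ### The Levinson–Durbin recursion -/

/-- The normalized forward and backward prediction polynomials of a stationary sequence with partial
autocorrelations `(α_k)_{k ≥ 1}`. -/
def levinsonPair (α : ℕ → ℝ) : ℕ → ℝ[T;T⁻¹] × ℝ[T;T⁻¹]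
  | 0 => (1, 1)
  | k + 1 =>
    (C (√(1 - α (k + 1) ^ 2))⁻¹ *
        ((levinsonPair α k).1 - C (α (k + 1)) * (T 1 * (levinsonPair α k).2)),
      C (√(1 - α (k + 1) ^ 2))⁻¹ *
        (T 1 * (levinsonPair α k).2 - C (α (k + 1)) * (levinsonPair α k).1))

/-- The forward prediction polynomial. -/
def predPoly (α : ℕ → ℝ) (k : ℕ) : ℝ[T;T⁻¹] := (levinsonPair α k).1

/-- The backward prediction polynomial. -/
def backPoly (α : ℕ → ℝ) (k : ℕ) : ℝ[T;T⁻¹] := (levinsonPair α k).2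

variable (α : ℕ → ℝ)

lemma predPoly_zero : predPoly α 0 = 1 := rfl

lemma backPoly_zero : backPoly α 0 = 1 := rfl

lemma predPoly_succ (k : ℕ) : predPoly α (k + 1) = C (√(1 - α (k + 1) ^ 2))⁻¹ *
    (predPoly α k - C (α (k + 1)) * (T 1 * backPoly α k)) := rfl

lemma backPoly_succ (k : ℕ) : backPoly α (k + 1) = C (√(1 - α (k + 1) ^ 2))⁻¹ *
    (T 1 * backPoly α k - C (α (k + 1)) * predPoly α k) := rfl

/-- Reversing the coefficients exchanges the two halves of the recursion. Hence both polynomials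
have the same ℓ¹ norm and act on ℓ² with the same norms. -/
lemma backPoly_eq (k : ℕ) : backPoly α k = T k * invert (predPoly α k) := by
  induction k with
  | zero => simp [predPoly_zero, backPoly_zero]
  | succ k ih =>
    have h : (T (k : ℤ) : ℝ[T;T⁻¹]) * T (-(k : ℤ)) = 1 := by rw [← T_add]; simp
    have h1 : (T (1 : ℤ) : ℝ[T;T⁻¹]) * T (-1) = 1 := by rw [← T_add]; simp
    rw [backPoly_succ, predPoly_succ, ih]
    simp only [map_mul, map_sub, invert_C, invert_T, involutive_invert (predPoly α k)]
    push_cast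
    rw [T_add]
    linear_combination (C (√(1 - α (k + 1) ^ 2))⁻¹ * C (α (k + 1)) * predPoly α k) *
      (h + T (k : ℤ) * T (-(k : ℤ)) * h1)

lemma coeffNorm_backPoly (k : ℕ) : coeffNorm (backPoly α k) = coeffNorm (predPoly α k) := by
  rw [backPoly_eq, coeffNorm_T_mul, coeffNorm_invert]

lemma coeff_backPoly (k : ℕ) (j : ℤ) :
    (backPoly α k).coeff j = (predPoly α k).coeff (k - j) := by
  rw [backPoly_eq, coeff_T_mul, invert_apply, neg_sub]

lemma coeff_predPoly_eq_zero (k : ℕ) (j : ℤ) (hj : j < 0 ∨ k < j) :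
    (predPoly α k).coeff j = 0 := by
  induction k generalizing j with
  | zero =>
    rw [predPoly_zero, ← T_zero, T_apply, if_neg]
    rintro rfl
    simp at hj
  | succ k ih =>
    rw [predPoly_succ, coeff_C_mul, AddMonoidAlgebra.coeff_sub, Finsupp.sub_apply, coeff_C_mul,
      coeff_T_mul, coeff_backPoly, ih, ih]
    · simp
    · push_cast at hj; omega
    · push_cast at hj; omega

lemma support_predPoly (k : ℕ) : (predPoly α k).coeff.support ⊆ Finset.Icc 0 (k : ℤ) := by
  intro j hj
  by_contra h
  rw [Finset.mem_Icc] at h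
  exact Finsupp.mem_support_iff.1 hj (coeff_predPoly_eq_zero α k j (by omega))

variable {α}

lemma one_sub_sq_pos (hα : ∀ k, 1 ≤ k → |α k| < 1) (k : ℕ) : 0 < 1 - α (k + 1) ^ 2 := by
  have := hα (k + 1) (by omega)
  have := (sq_lt_one_iff_abs_lt_one _).2 this
  linarith

lemma coeff_predPoly_zero_pos (hα : ∀ k, 1 ≤ k → |α k| < 1) (k : ℕ) :
    0 < (predPoly α k).coeff 0 := by
  induction k with
  | zero => simp [predPoly_zero, ← T_zero]
  | succ k ih =>
    rw [predPoly_succ, coeff_C_mul, AddMonoidAlgebra.coeff_sub, Finsupp.sub_apply, coeff_C_mul,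
      coeff_T_mul, coeff_backPoly, coeff_predPoly_eq_zero α k (k - (0 - 1)) (by omega)]
    have := Real.sqrt_pos.2 (one_sub_sq_pos hα k)
    simp only [mul_zero, sub_zero]
    positivity

lemma inv_sqrt_mul_le (hα : ∀ k, 1 ≤ k → |α k| < 1) (k : ℕ) :
    (√(1 - α (k + 1) ^ 2))⁻¹ * (1 + |α (k + 1)|) ≤
    (1 + |α (k + 1)|) / (1 - |α (k + 1)|) := by
  have h := hα (k + 1) (by omega)
  have h0 := abs_nonneg (α (k + 1))
  have h1 : 1 - |α (k + 1)| ≤ √(1 - α (k + 1) ^ 2) := by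
    apply Real.le_sqrt_of_sq_le
    rw [← sq_abs (α (k + 1))]
    nlinarith
  rw [div_eq_inv_mul]
  gcongr

/-- The triangle inequality gives the factor (1 + |α|)/√(1 - α²). It is weakened to (1 + |α|)/(1 -
|α|), the factor of the ℓ² estimate, so that one product controls both norms. -/
lemma coeffNorm_predPoly_succ_le (hα : ∀ k, 1 ≤ k → |α k| < 1) (k : ℕ) :
    coeffNorm (predPoly α (k + 1)) ≤
    (1 + |α (k + 1)|) / (1 - |α (k + 1)|) * coeffNorm (predPoly α k) := by
  have h2 := coeffNorm_sub_le (predPoly α k) (C (α (k + 1)) * (T 1 * backPoly α k))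
  rw [coeffNorm_C_mul, coeffNorm_T_mul, coeffNorm_backPoly] at h2
  rw [predPoly_succ, coeffNorm_C_mul, abs_of_nonneg (inv_nonneg.2 (Real.sqrt_nonneg _))]
  calc _ ≤ (√(1 - α (k + 1) ^ 2))⁻¹ * ((1 + |α (k + 1)|) * coeffNorm (predPoly α k)) := by
        gcongr; linarith
    _ ≤ _ := by
        rw [← mul_assoc]
        exact mul_le_mul_of_nonneg_right (inv_sqrt_mul_le hα k) (coeffNorm_nonneg _)

lemma coeffInner_backPoly_mul (k : ℕ) (f : ℝ[T;T⁻¹]) :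
    coeffInner (backPoly α k * f) (backPoly α k * f) =
      coeffInner (predPoly α k * f) (predPoly α k * f) := by
  rw [backPoly_eq, mul_assoc, coeffInner_T_mul, coeffInner, coeffInner]
  congr 1
  simp only [map_mul, involutive_invert (predPoly α k)]
  ring_nf

lemma two_mul_abs_coeffInner_le (f g : ℝ[T;T⁻¹]) :
    2 * |coeffInner f g| ≤ coeffInner f f + coeffInner g g := by
  have h1 := coeffInner_self_nonneg (C 1 * f + C 1 * g)
  have h2 := coeffInner_self_nonneg (C 1 * f + C (-1) * g)
  rw [coeffInner_C_mul_add] at h1 h2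
  rcases abs_cases (coeffInner f g) with h | h <;> rw [h.1] <;> linarith

/-- With q the shifted backward term, p and q have equal ℓ² norm, so the square norm of p - αq lies
between (1 - |α|)² and (1 + |α|)² times that of p; dividing by 1 - α² = (1 - |α|)(1 + |α|) gives the
ratios. The arbitrary factor f makes this a bound on the multiplication operator, replacing
pointwise bounds of |p|² on the unit circle. -/
lemma coeffInner_predPoly_succ (hα : ∀ k, 1 ≤ k → |α k| < 1) (k : ℕ) (f : ℝ[T;T⁻¹]) :
    (1 - |α (k + 1)|) / (1 + |α (k + 1)|) * coeffInner (predPoly α k * f) (predPoly α k * f) ≤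
      coeffInner (predPoly α (k + 1) * f) (predPoly α (k + 1) * f) ∧
    coeffInner (predPoly α (k + 1) * f) (predPoly α (k + 1) * f) ≤
    (1 + |α (k + 1)|) / (1 - |α (k + 1)|) *
      coeffInner (predPoly α k * f) (predPoly α k * f) := by
  set r := (√(1 - α (k + 1) ^ 2))⁻¹ with hr
  set p := predPoly α k * f with hp
  set q := T 1 * (backPoly α k * f) with hq
  have hpq : predPoly α (k + 1) * f = C r * p + C (-(r * α (k + 1))) * q := by
    rw [predPoly_succ, hp, hq, map_neg, map_mul]
    ring
  have hqq : coeffInner q q = coeffInner p p := by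
    rw [hq, coeffInner_T_mul, coeffInner_backPoly_mul]
  have hb := two_mul_abs_coeffInner_le p q
  have hr2 : r ^ 2 = (1 - α (k + 1) ^ 2)⁻¹ := by
    rw [hr, inv_pow, Real.sq_sqrt (one_sub_sq_pos hα k).le]
  have habs : |2 * α (k + 1) * coeffInner p q| ≤ 2 * |α (k + 1)| * coeffInner p p := by
    rw [abs_mul, abs_mul, abs_two]
    have := mul_le_mul_of_nonneg_left hb (abs_nonneg (α (k + 1)))
    rw [hqq] at this
    linarith
  have hval : coeffInner (predPoly α (k + 1) * f) (predPoly α (k + 1) * f) =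
      (1 - α (k + 1) ^ 2)⁻¹ * ((1 + |α (k + 1)| ^ 2) * coeffInner p p -
        2 * α (k + 1) * coeffInner p q) := by
    rw [hpq, coeffInner_C_mul_add, hqq, sq_abs, ← hr2]
    ring
  have h1 := hα (k + 1) (by omega)
  have h0 := abs_nonneg (α (k + 1))
  have hd : 1 - α (k + 1) ^ 2 = (1 - |α (k + 1)|) * (1 + |α (k + 1)|) := by
    rw [← sq_abs]; ring
  have hpos : 0 < 1 - |α (k + 1)| := by linarith
  obtain ⟨hl, hu⟩ := abs_le.1 habs
  rw [hval, hd]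
  constructor
  · rw [div_mul_eq_mul_div, div_le_iff₀ (by positivity)]
    have : ((1 - |α (k + 1)|) * (1 + |α (k + 1)|))⁻¹ * ((1 + |α (k + 1)| ^ 2) * coeffInner p p -
        2 * α (k + 1) * coeffInner p q) * (1 + |α (k + 1)|) =
        ((1 + |α (k + 1)| ^ 2) * coeffInner p p - 2 * α (k + 1) * coeffInner p q) /
          (1 - |α (k + 1)|) := by
      field_simp
    rw [this, le_div_iff₀ hpos]
    linarith
  · rw [div_mul_eq_mul_div, le_div_iff₀ hpos]
    have : ((1 - |α (k + 1)|) * (1 + |α (k + 1)|))⁻¹ * ((1 + |α (k + 1)| ^ 2) * coeffInner p p -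
        2 * α (k + 1) * coeffInner p q) * (1 - |α (k + 1)|) =
        ((1 + |α (k + 1)| ^ 2) * coeffInner p p - 2 * α (k + 1) * coeffInner p q) /
          (1 + |α (k + 1)|) := by
      field_simp
    rw [this, div_le_iff₀ (by positivity)]
    linarith

lemma exists_pos_le_one_sub_abs (hα : ∀ k, 1 ≤ k → |α k| < 1)
    (hsum : Summable fun k : ℕ => |α (k + 1)|) : ∃ δ > 0, ∀ k, δ ≤ 1 - |α (k + 1)| := by
  obtain ⟨N, hN⟩ := ((hsum.tendsto_atTop_zero).eventually (gt_mem_nhds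
    (show (0 : ℝ) < 1 / 2 by norm_num))).exists_forall_of_atTop
  have hne : (Finset.range (N + 1)).Nonempty := ⟨0, by simp⟩
  refine ⟨min (1 / 2) ((Finset.range (N + 1)).inf' hne fun k => 1 - |α (k + 1)|),
    lt_min (by norm_num) ?_, fun k => ?_⟩
  · rw [Finset.lt_inf'_iff]
    intro k _
    have := hα (k + 1) (by omega)
    linarith
  · rcases le_or_gt N k with h | h
    · have := hN k h
      exact (min_le_left _ _).trans (by linarith)
    · exact (min_le_right _ _).trans
        (Finset.inf'_le (fun k => 1 - |α (k + 1)|) (Finset.mem_range.2 (by omega)))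

/-- Each factor equals 1 + 2|α|/(1 - |α|) ≤ 1 + (2/δ)|α| ≤ exp((2/δ)|α|). -/
lemma exists_prod_ratio_le (hα : ∀ k, 1 ≤ k → |α k| < 1)
    (hsum : Summable fun k : ℕ => |α (k + 1)|) : ∃ B : ℝ, ∀ n,
    ∏ k ∈ Finset.range n, (1 + |α (k + 1)|) / (1 - |α (k + 1)|) ≤ B := by
  obtain ⟨δ, hδ, h⟩ := exists_pos_le_one_sub_abs hα hsum
  refine ⟨Real.exp (∑' k, 2 / δ * |α (k + 1)|), fun n => ?_⟩
  have hs : Summable fun k => 2 / δ * |α (k + 1)| := hsum.mul_left _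
  calc _ ≤ ∏ k ∈ Finset.range n, Real.exp (2 / δ * |α (k + 1)|) := by
        refine Finset.prod_le_prod (fun k _ => ?_) fun k _ => ?_
        · have := h k
          have : 0 < 1 - |α (k + 1)| := by linarith
          positivity
        · have hk := h k
          have hk' : 0 < 1 - |α (k + 1)| := by linarith
          refine le_trans ?_ (Real.add_one_le_exp _)
          rw [div_le_iff₀ hk']
          have h1 : 2 / δ * |α (k + 1)| * δ ≤ 2 / δ * |α (k + 1)| * (1 - |α (k + 1)|) := by
            gcongr
          have h2 : 2 / δ * |α (k + 1)| * δ = 2 * |α (k + 1)| := by field_simp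
          linarith
    _ = Real.exp (∑ k ∈ Finset.range n, 2 / δ * |α (k + 1)|) := (Real.exp_sum _ _).symm
    _ ≤ _ := by
        refine Real.exp_le_exp.2 (hs.sum_le_tsum _ fun k _ => ?_)
        positivity

lemma exists_predPoly_bound (hα : ∀ k, 1 ≤ k → |α k| < 1)
    (hsum : Summable fun k : ℕ => |α (k + 1)|) :
    ∃ B : ℝ, 1 ≤ B ∧ ∀ k, coeffNorm (predPoly α k) ≤ B ∧
    ∀ f, B⁻¹ * coeffInner f f ≤ coeffInner (predPoly α k * f) (predPoly α k * f) ∧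
      coeffInner (predPoly α k * f) (predPoly α k * f) ≤ B * coeffInner f f := by
  obtain ⟨B, hB⟩ := exists_prod_ratio_le hα hsum
  have hpos : ∀ k, 0 < (1 + |α (k + 1)|) / (1 - |α (k + 1)|) := fun k => by
    have := hα (k + 1) (by omega)
    have : 0 < 1 - |α (k + 1)| := by linarith
    positivity
  have key : ∀ k, coeffNorm (predPoly α k) ≤
      ∏ k ∈ Finset.range k, (1 + |α (k + 1)|) / (1 - |α (k + 1)|) ∧
    ∀ f, (∏ k ∈ Finset.range k, (1 + |α (k + 1)|) / (1 - |α (k + 1)|))⁻¹ * coeffInner f f ≤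
        coeffInner (predPoly α k * f) (predPoly α k * f) ∧
      coeffInner (predPoly α k * f) (predPoly α k * f) ≤
        (∏ k ∈ Finset.range k, (1 + |α (k + 1)|) / (1 - |α (k + 1)|)) * coeffInner f f := by
    intro k
    induction k with
    | zero => simp [predPoly_zero, coeffNorm_one]
    | succ k ih =>
      rw [Finset.prod_range_succ]
      set P := ∏ k ∈ Finset.range k, (1 + |α (k + 1)|) / (1 - |α (k + 1)|)
      have hk := hpos k
      refine ⟨(coeffNorm_predPoly_succ_le hα k).trans ?_, fun f => ?_⟩
      · rw [mul_comm P]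
        exact mul_le_mul_of_nonneg_left ih.1 hk.le
      · obtain ⟨h1, h2⟩ := coeffInner_predPoly_succ hα k f
        obtain ⟨h3, h4⟩ := ih.2 f
        constructor
        · refine le_trans ?_ h1
          rw [mul_inv, inv_div, mul_comm P⁻¹, mul_assoc]
          refine mul_le_mul_of_nonneg_left h3 ?_
          rw [← inv_div]
          exact (inv_pos.2 hk).le
        · refine h2.trans ?_
          rw [mul_comm P, mul_assoc]
          exact mul_le_mul_of_nonneg_left h4 hk.le
  -- The empty product gives 1 ≤ B.
  refine ⟨B, by simpa using hB 0, fun k => ⟨(key k).1.trans (hB k), fun f => ?_⟩⟩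
  have h0 := coeffInner_self_nonneg f
  have hP : 0 < ∏ k ∈ Finset.range k, (1 + |α (k + 1)|) / (1 - |α (k + 1)|) :=
    Finset.prod_pos fun k _ => hpos k
  refine ⟨le_trans ?_ ((key k).2 f).1, ((key k).2 f).2.trans ?_⟩
  · have := hB k
    gcongr
  · exact mul_le_mul_of_nonneg_right (hB k) h0

lemma summable_coeffNorm_predPoly_sub (hα : ∀ k, 1 ≤ k → |α k| < 1)
    (hsum : Summable fun k : ℕ => |α (k + 1)|) :
    Summable fun k => coeffNorm (predPoly α (k + 1) - predPoly α k) := by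
  obtain ⟨δ, hδ, h⟩ := exists_pos_le_one_sub_abs hα hsum
  obtain ⟨B, hB1, hB⟩ := exists_predPoly_bound hα hsum
  refine Summable.of_nonneg_of_le (fun k => coeffNorm_nonneg _) (fun k => ?_)
    (hsum.mul_left (2 / δ * B))
  set a := |α (k + 1)| with ha
  set r := √(1 - α (k + 1) ^ 2) with hr
  have ha0 : 0 ≤ a := abs_nonneg _
  have ha1 : a < 1 := hα (k + 1) (by omega)
  have hra : 1 - a ≤ r := by
    apply Real.le_sqrt_of_sq_le
    rw [← sq_abs (α (k + 1))]
    nlinarith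
  have hrδ : δ ≤ r := (h k).trans hra
  have hr0 : 0 < r := hδ.trans_le hrδ
  have hr1 : r ≤ 1 := by
    rw [hr, Real.sqrt_le_one]
    nlinarith [sq_nonneg (α (k + 1))]
  -- Both coefficients are of order |α|, because 1 - r ≤ |α|; together they contribute at most
  -- 2|α|/δ.
  have hdec : predPoly α (k + 1) - predPoly α k =
      C (r⁻¹ - 1) * predPoly α k - C (r⁻¹ * α (k + 1)) * (T 1 * backPoly α k) := by
    rw [predPoly_succ, map_sub, map_mul, map_one, ← hr]
    ring
  rw [hdec]
  refine (coeffNorm_sub_le _ _).trans ?_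
  rw [coeffNorm_C_mul, coeffNorm_C_mul, coeffNorm_T_mul, coeffNorm_backPoly, ← add_mul, abs_mul,
    abs_of_nonneg (sub_nonneg.2 ((one_le_inv₀ hr0).2 hr1)), abs_of_pos (inv_pos.2 hr0), ← ha]
  have h1 : r⁻¹ - 1 + r⁻¹ * a ≤ 2 / δ * a := by
    have e : r⁻¹ - 1 + r⁻¹ * a = (1 - r + a) / r := by field_simp
    rw [e, div_mul_eq_mul_div]
    exact div_le_div₀ (by positivity) (by linarith) hδ hrδ
  calc _ ≤ 2 / δ * a * B := by
        exact mul_le_mul h1 (hB k).1 (coeffNorm_nonneg _) (by positivity)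
    _ = _ := by ring

end

section

/-! ### Powers of the defect `1 - p p* / B` -/

lemma coeff_mul_eq_sum (f g : ℝ[T;T⁻¹]) (j : ℤ) :
    (f * g).coeff j = ∑ i ∈ f.coeff.support, f.coeff i * g.coeff (j - i) := by
  conv_lhs => rw [eq_sum_C_mul_T f]
  simp only [Finset.sum_mul, AddMonoidAlgebra.coeff_sum, Finsupp.finsetSum_apply, mul_assoc,
    coeff_C_mul, coeff_T_mul]

lemma coeff_mul_eq_zero {f g : ℝ[T;T⁻¹]} {a b : ℕ}
    (hf : ∀ j : ℤ, a < |j| → f.coeff j = 0) (hg : ∀ j : ℤ, b < |j| → g.coeff j = 0) (j : ℤ)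
    (hj : (a + b : ℕ) < |j|) : (f * g).coeff j = 0 := by
  rw [coeff_mul_eq_sum]
  refine Finset.sum_eq_zero fun i _ => ?_
  by_cases hi : (a : ℤ) < |i|
  · rw [hf i hi, zero_mul]
  · rw [hg (j - i), mul_zero]
    have := abs_sub_abs_le_abs_sub j i
    push_cast at hj
    omega

lemma coeff_pow_eq_zero {f : ℝ[T;T⁻¹]} {a : ℕ} (hf : ∀ j : ℤ, a < |j| → f.coeff j = 0) (n : ℕ)
    (j : ℤ) (hj : (a * n : ℕ) < |j|) : (f ^ n).coeff j = 0 := by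
  induction n generalizing j with
  | zero =>
    rw [pow_zero, ← T_zero, T_apply, if_neg]
    rintro rfl
    simp at hj
  | succ n ih =>
    rw [pow_succ]
    exact coeff_mul_eq_zero ih hf j (by rwa [Nat.mul_succ] at hj)

lemma card_support_le {f : ℝ[T;T⁻¹]} {a : ℕ} (hf : ∀ j : ℤ, a < |j| → f.coeff j = 0) :
    f.coeff.support.card ≤ 2 * a + 1 := by
  have h : f.coeff.support ⊆ Finset.Icc (-(a : ℤ)) a := by
    intro j hj
    rw [Finset.mem_Icc, ← abs_le]
    by_contra hc
    exact Finsupp.mem_support_iff.1 hj (hf j (not_le.1 hc))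
  refine (Finset.card_le_card h).trans ?_
  rw [Int.card_Icc]
  omega

/-- The Laurent polynomial `1 - p_m p_m* / B`. -/
def defect (α : ℕ → ℝ) (B : ℝ) (m : ℕ) : ℝ[T;T⁻¹] :=
  1 - C B⁻¹ * (predPoly α m * invert (predPoly α m))

variable {α : ℕ → ℝ} {B : ℝ}

lemma coeff_defect_eq_zero (m : ℕ) (j : ℤ) (hj : m < |j|) : (defect α B m).coeff j = 0 := by
  have h1 : (predPoly α m * invert (predPoly α m)).coeff j = 0 := by
    rw [coeff_mul_eq_sum]
    refine Finset.sum_eq_zero fun i hi => ?_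
    have hi := Finset.mem_Icc.1 (support_predPoly α m hi)
    rw [invert_apply, coeff_predPoly_eq_zero α m (-(j - i)), mul_zero]
    rcases lt_abs.1 hj with h | h <;> omega
  rw [defect, AddMonoidAlgebra.coeff_sub, Finsupp.sub_apply, coeff_C_mul, h1, ← T_zero, T_apply,
    if_neg, mul_zero, sub_zero]
  rintro rfl
  simp at hj
  omega

/-- Expanding the square gives |f|² - (2/B)|pf|² + B⁻²|p*pf|². Since p* and p act with equal norms,
the last term is at most |pf|²/B, and what remains, |f|² - |pf|²/B, is at most (1 - B⁻²)|f|². -/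
lemma coeffInner_defect_mul_le (hB : 0 < B) {m : ℕ}
    (h : ∀ f, B⁻¹ * coeffInner f f ≤ coeffInner (predPoly α m * f) (predPoly α m * f) ∧
      coeffInner (predPoly α m * f) (predPoly α m * f) ≤ B * coeffInner f f) (f : ℝ[T;T⁻¹]) :
    coeffInner (defect α B m * f) (defect α B m * f) ≤ (1 - (B ^ 2)⁻¹) * coeffInner f f := by
  set p := predPoly α m with hp
  set v := invert p * (p * f) with hv
  have hN : defect α B m * f = C 1 * f + C (-B⁻¹) * v := by
    rw [defect, hv, map_neg, map_one, ← hp]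
    ring
  have hfv : coeffInner f v = coeffInner (p * f) (p * f) := by
    rw [coeffInner, coeffInner, hv]
    congr 1
    simp only [map_mul, involutive_invert p]
    ring_nf
  have hvv : coeffInner v v = coeffInner (p * (p * f)) (p * (p * f)) := by
    rw [coeffInner, coeffInner, hv]
    congr 1
    simp only [map_mul, involutive_invert p]
    ring_nf
  have h1 := (h f).1
  have h2 := (h (p * f)).2
  rw [hN, coeffInner_C_mul_add, hfv, hvv]
  set u := coeffInner (p * f) (p * f)
  have h3 : (-B⁻¹) ^ 2 * coeffInner (p * (p * f)) (p * (p * f)) ≤ B⁻¹ * u := by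
    calc _ ≤ (-B⁻¹) ^ 2 * (B * u) := by gcongr
      _ = _ := by field_simp
  have h4 : (B ^ 2)⁻¹ * coeffInner f f ≤ B⁻¹ * u := by
    calc _ = B⁻¹ * (B⁻¹ * coeffInner f f) := by field_simp
      _ ≤ _ := by gcongr
  linarith

lemma coeffInner_defect_pow_le (hB : 1 ≤ B) {m : ℕ}
    (h : ∀ f, B⁻¹ * coeffInner f f ≤ coeffInner (predPoly α m * f) (predPoly α m * f) ∧
      coeffInner (predPoly α m * f) (predPoly α m * f) ≤ B * coeffInner f f) (n : ℕ) :
    coeffInner (defect α B m ^ n) (defect α B m ^ n) ≤ (1 - (B ^ 2)⁻¹) ^ n := by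
  induction n with
  | zero =>
    rw [pow_zero, coeffInner, ← T_zero]
    simp
  | succ n ih =>
    rw [pow_succ', pow_succ']
    refine (coeffInner_defect_mul_le (by linarith) h _).trans (mul_le_mul_of_nonneg_left ih ?_)
    rw [sub_nonneg]
    exact inv_le_one_of_one_le₀ (one_le_pow₀ hB)

/-- The n-th power is supported in [-mn, mn]. The linear prefactor depends on m, so this bound alone
is not uniform in the order. -/
lemma coeffNorm_defect_pow_le (hB : 1 ≤ B) {m : ℕ}
    (h : ∀ f, B⁻¹ * coeffInner f f ≤ coeffInner (predPoly α m * f) (predPoly α m * f) ∧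
      coeffInner (predPoly α m * f) (predPoly α m * f) ≤ B * coeffInner f f) (n : ℕ) :
    coeffNorm (defect α B m ^ n) ≤ (2 * m * n + 1) * √(1 - (B ^ 2)⁻¹) ^ n := by
  have h0 : 0 ≤ 1 - (B ^ 2)⁻¹ := by
    rw [sub_nonneg]
    exact inv_le_one_of_one_le₀ (one_le_pow₀ hB)
  refine le_of_sq_le_sq ?_ (by positivity)
  have hc : ((defect α B m ^ n).coeff.support.card : ℝ) ≤ 2 * m * n + 1 := by
    have := card_support_le (coeff_pow_eq_zero (coeff_defect_eq_zero (α := α) (B := B) m) n)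
    calc _ ≤ ((2 * (m * n) + 1 : ℕ) : ℝ) := by exact_mod_cast this
      _ = _ := by push_cast; ring
  calc coeffNorm (defect α B m ^ n) ^ 2
      ≤ (2 * m * n + 1) * (1 - (B ^ 2)⁻¹) ^ n :=
        (coeffNorm_sq_le _).trans (mul_le_mul hc (coeffInner_defect_pow_le hB h n)
          (coeffInner_self_nonneg _) (by positivity))
    -- Squaring the prefactor is wasteful but makes the right-hand side a perfect square.
    _ ≤ (2 * m * n + 1) ^ 2 * (1 - (B ^ 2)⁻¹) ^ n := by
        gcongr
        exact le_self_pow₀ (by norm_cast; omega) (by norm_num)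
    _ = _ := by rw [mul_pow, pow_right_comm, Real.sq_sqrt h0]

lemma exists_linear_mul_pow_le {q s : ℝ} (hq : 0 ≤ q) (hs : q < s) (c : ℝ) :
    ∃ A, 0 < A ∧ ∀ n : ℕ, (c * n + 1) * q ^ n ≤ A * s ^ n := by
  have hs0 : 0 < s := hq.trans_lt hs
  have hr : |q / s| < 1 := by
    rw [abs_of_nonneg (by positivity), div_lt_one hs0]
    exact hs
  have h1 := (tendsto_pow_const_mul_const_pow_of_abs_lt_one 1 hr).const_mul c
  have h2 := tendsto_pow_atTop_nhds_zero_of_abs_lt_one hr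
  obtain ⟨A, hA⟩ := (h1.add h2).bddAbove_range
  refine ⟨max A 1, lt_max_of_lt_right one_pos, fun n => ?_⟩
  have h3 : c * ((n : ℝ) ^ 1 * (q / s) ^ n) + (q / s) ^ n ≤ max A 1 :=
    (hA ⟨n, rfl⟩).trans (le_max_left _ _)
  calc (c * n + 1) * q ^ n = (c * ((n : ℝ) ^ 1 * (q / s) ^ n) + (q / s) ^ n) * s ^ n := by
        rw [div_pow]
        field_simp
    _ ≤ _ := by gcongr

lemma coeffNorm_defect_sub_le (hB : 1 ≤ B) (h : ∀ k, coeffNorm (predPoly α k) ≤ B) (m n : ℕ) :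
    coeffNorm (defect α B m - defect α B n) ≤
      2 * coeffNorm (predPoly α m - predPoly α n) := by
  have e : defect α B m - defect α B n = C (-B⁻¹) *
      ((predPoly α m - predPoly α n) * invert (predPoly α m) +
        predPoly α n * invert (predPoly α m - predPoly α n)) := by
    simp only [defect, map_neg, map_sub]
    ring
  have h0 := coeffNorm_nonneg (predPoly α m - predPoly α n)
  have h1 : coeffNorm ((predPoly α m - predPoly α n) * invert (predPoly α m) +
      predPoly α n * invert (predPoly α m - predPoly α n)) ≤
      B * (2 * coeffNorm (predPoly α m - predPoly α n)) := by
    refine (coeffNorm_add_le _ _).trans ?_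
    have h2 := coeffNorm_mul_le (predPoly α m - predPoly α n) (invert (predPoly α m))
    have h3 := coeffNorm_mul_le (predPoly α n) (invert (predPoly α m - predPoly α n))
    rw [coeffNorm_invert] at h2 h3
    have h4 := mul_le_mul_of_nonneg_left (h m) h0
    have h5 := mul_le_mul_of_nonneg_right (h n) h0
    linarith
  rw [e, coeffNorm_C_mul, abs_neg, abs_of_nonneg (by positivity)]
  calc _ ≤ B⁻¹ * (B * (2 * coeffNorm (predPoly α m - predPoly α n))) := by gcongr
    _ = _ := by field_simp

lemma coeffNorm_predPoly_sub_le
    (hs : Summable fun k => coeffNorm (predPoly α (k + 1) - predPoly α k)) (m j : ℕ) :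
    coeffNorm (predPoly α (m + j) - predPoly α m) ≤
      ∑' k, coeffNorm (predPoly α (k + m + 1) - predPoly α (k + m)) := by
  have hs' : Summable fun k => coeffNorm (predPoly α (k + m + 1) - predPoly α (k + m)) :=
    (summable_nat_add_iff (f := fun k => coeffNorm (predPoly α (k + 1) - predPoly α k)) m).2 hs
  refine le_trans ?_ (hs'.sum_le_tsum (Finset.range j) fun _ _ => coeffNorm_nonneg _)
  have := Finset.sum_range_sub (fun k => predPoly α (k + m)) j
  have h2 : predPoly α (m + j) - predPoly α m =
      ∑ i ∈ Finset.range j, (predPoly α (i + m + 1) - predPoly α (i + m)) := by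
    rw [add_comm m j]
    simpa [add_right_comm] using this.symm
  rw [h2]
  exact coeffNorm_sum_le _ _

lemma tendsto_tail_coeffNorm_predPoly (α : ℕ → ℝ) :
    Tendsto (fun m => ∑' k, coeffNorm (predPoly α (k + m + 1) - predPoly α (k + m))) atTop (𝓝 0) :=
  tendsto_sum_nat_add fun k => coeffNorm (predPoly α (k + 1) - predPoly α k)

/-- All defects of order m ≥ M lie within η of the one of order M in ℓ¹. The ring is commutative, so
the binomial theorem bounds the powers of the perturbed defect by A((q + η) + η)^n. -/
lemma exists_coeffNorm_defect_pow_le (hB : 1 ≤ B)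
    (h : ∀ k, coeffNorm (predPoly α k) ≤ B ∧
      ∀ f, B⁻¹ * coeffInner f f ≤ coeffInner (predPoly α k * f) (predPoly α k * f) ∧
        coeffInner (predPoly α k * f) (predPoly α k * f) ≤ B * coeffInner f f)
    (hs : Summable fun k => coeffNorm (predPoly α (k + 1) - predPoly α k)) :
    ∃ A θ : ℝ, ∃ M : ℕ, 0 < A ∧ 0 < θ ∧ θ < 1 ∧
      ∀ m, M ≤ m → ∀ n, coeffNorm (defect α B m ^ n) ≤ A * θ ^ n := by
  set q := √(1 - (B ^ 2)⁻¹) with hq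
  have hq0 : 0 ≤ q := Real.sqrt_nonneg _
  have hq1 : q < 1 := by
    rw [hq, Real.sqrt_lt' one_pos]
    have : 0 < (B ^ 2)⁻¹ := by positivity
    linarith
  -- One η absorbs the linear prefactor, the other is the perturbation; q + 2η is still below 1.
  set η := (1 - q) / 4 with hη
  have hη0 : 0 < η := by rw [hη]; linarith
  obtain ⟨M, hM⟩ := ((tendsto_tail_coeffNorm_predPoly α).eventually
    (gt_mem_nhds (half_pos hη0))).exists
  obtain ⟨A, hA0, hA⟩ := exists_linear_mul_pow_le hq0 (show q < q + η by linarith) (2 * M)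
  refine ⟨A, q + η + η, M, hA0, by linarith, by linarith, fun m hm n => ?_⟩
  obtain ⟨j, rfl⟩ := Nat.exists_eq_add_of_le hm
  set R := defect α B (M + j) - defect α B M with hR
  have hRn : coeffNorm R ≤ η := by
    refine (coeffNorm_defect_sub_le hB (fun k => (h k).1) _ _).trans ?_
    have := coeffNorm_predPoly_sub_le hs M j
    linarith
  have hsum : defect α B (M + j) = defect α B M + R := by rw [hR]; ring
  rw [hsum, add_pow, add_pow, Finset.mul_sum]
  refine (coeffNorm_sum_le _ _).trans (Finset.sum_le_sum fun i hi => ?_)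
  have hcast : ((n.choose i : ℕ) : ℝ[T;T⁻¹]) = C (n.choose i : ℝ) := by simp
  rw [hcast, mul_comm _ (C _), coeffNorm_C_mul, abs_of_nonneg (by positivity)]
  have h1 : coeffNorm (defect α B M ^ i * R ^ (n - i)) ≤ A * (q + η) ^ i * η ^ (n - i) := by
    refine (coeffNorm_mul_le _ _).trans ?_
    have h2 := (coeffNorm_defect_pow_le hB (h M).2 i).trans (hA i)
    have h3 := (coeffNorm_pow_le R (n - i)).trans
      (pow_le_pow_left₀ (coeffNorm_nonneg _) hRn _)
    exact mul_le_mul h2 h3 (coeffNorm_nonneg _) (by positivity)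
  calc _ ≤ (n.choose i : ℝ) * (A * (q + η) ^ i * η ^ (n - i)) := by gcongr
    _ = _ := by ring

/-! ### Summability of the autocovariances -/

/-- Errors of equal order m at lag l are only nearly orthogonal. Raising the order of the later one
to m + |l| makes both prediction windows start at the same time, where `horth` is exact; the change
costs an ℓ¹ tail of the sequence of p_k. -/
lemma abs_pairing_predPoly_sub_le {γ : ℤ → ℝ} (hγ : ∀ j, |γ j| ≤ 1) (hB : 1 ≤ B)
    (h : ∀ k, coeffNorm (predPoly α k) ≤ B)
    (hs : Summable fun k => coeffNorm (predPoly α (k + 1) - predPoly α k))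
    (horth : ∀ i j : ℕ, pairing γ (T ((j : ℤ) - i) * (predPoly α i * invert (predPoly α j))) =
      if i = j then 1 else 0) (m : ℕ) (l : ℤ) :
    |pairing γ (T l * (predPoly α m * invert (predPoly α m))) - if l = 0 then 1 else 0| ≤
      B * ∑' k, coeffNorm (predPoly α (k + m + 1) - predPoly α (k + m)) := by
  have key : ∀ f g e : ℝ[T;T⁻¹], ∀ l : ℤ, e = T l * (f * g) →
      |pairing γ e| ≤ coeffNorm f * coeffNorm g := by
    rintro f g e l rfl
    refine (abs_pairing_le hγ _).trans ?_
    rw [mul_one, coeffNorm_T_mul]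
    exact coeffNorm_mul_le f g
  rcases le_or_gt 0 l with hl | hl
  · obtain ⟨j, rfl⟩ := Int.eq_ofNat_of_zero_le hl
    have h1 := horth m (m + j)
    have e1 : (((m + j : ℕ) : ℤ) - (m : ℤ)) = (j : ℤ) := by push_cast; ring
    have e2 : (if m = m + j then (1 : ℝ) else 0) = if (j : ℤ) = 0 then 1 else 0 := by
      congr 1; simp
    rw [e1, e2] at h1
    rw [← h1, abs_sub_comm, ← map_sub]
    refine (key (predPoly α m) (invert (predPoly α (m + j) - predPoly α m)) _ j ?_).trans ?_
    · rw [map_sub]; ring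
    · rw [coeffNorm_invert]
      exact mul_le_mul (h m) (coeffNorm_predPoly_sub_le hs m j) (coeffNorm_nonneg _) (by linarith)
  · obtain ⟨j, hj⟩ := Int.eq_ofNat_of_zero_le (show 0 ≤ -l by omega)
    have h1 := horth (m + j) m
    have e1 : ((m : ℤ) - ((m + j : ℕ) : ℤ)) = l := by push_cast; omega
    have e2 : (if m + j = m then (1 : ℝ) else 0) = if l = 0 then 1 else 0 := by
      congr 1
      simp only [Nat.add_eq_left, eq_iff_iff]
      omega
    rw [e1, e2] at h1
    rw [← h1, abs_sub_comm, ← map_sub]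
    refine (key (predPoly α (m + j) - predPoly α m) (invert (predPoly α m)) _ l ?_).trans ?_
    · ring
    · rw [coeffNorm_invert, mul_comm]
      exact mul_le_mul (h m) (coeffNorm_predPoly_sub_le hs m j) (coeffNorm_nonneg _) (by linarith)

/-- **Baxter's theorem**: absolutely summable partial autocorrelations give absolutely summable
autocorrelations. -/
theorem summable_abs_autocorrelation (hα : ∀ k, 1 ≤ k → |α k| < 1)
    (hsum : Summable fun k : ℕ => |α (k + 1)|) {γ : ℤ → ℝ} (hγ : ∀ j, |γ j| ≤ 1)
    (horth : ∀ i j : ℕ, pairing γ (T ((j : ℤ) - i) * (predPoly α i * invert (predPoly α j))) =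
      if i = j then 1 else 0) : Summable fun j => |γ j| := by
  obtain ⟨B, hB, h⟩ := exists_predPoly_bound hα hsum
  have hs := summable_coeffNorm_predPoly_sub hα hsum
  obtain ⟨A, θ, M, hA, hθ0, hθ1, hN⟩ := exists_coeffNorm_defect_pow_le hB h hs
  have hB0 : 0 < B := by linarith
  set S := A * (1 - θ)⁻¹ with hS
  set τ : ℕ → ℝ := fun m => ∑' k, coeffNorm (predPoly α (k + m + 1) - predPoly α (k + m)) with hτ
  have hτ0 : Tendsto τ atTop (𝓝 0) := tendsto_tail_coeffNorm_predPoly α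
  have hG : ∀ m, M ≤ m → coeffNorm (∑ i ∈ Finset.range m, defect α B m ^ i) ≤ S := by
    intro m hm
    refine (coeffNorm_sum_le _ _).trans
      ((Finset.sum_le_sum fun i _ => hN m hm i).trans ?_)
    rw [← Finset.mul_sum, hS, ← tsum_geometric_of_lt_one hθ0.le hθ1]
    gcongr
    exact (summable_geometric_of_lt_one hθ0.le hθ1).sum_le_tsum _ fun _ _ => by positivity
  -- The error term does not depend on j, so it can be summed over a finite set before m tends to
  -- infinity.
  have hpt : ∀ m, M ≤ m → ∀ j : ℤ, |γ j| ≤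
      |(∑ i ∈ Finset.range m, defect α B m ^ i).coeff (-j)| + (S * (B * τ m) + A * θ ^ m) := by
    intro m hm j
    set G := ∑ i ∈ Finset.range m, defect α B m ^ i with hGdef
    set w : ℤ → ℝ := fun l => pairing γ (T l * (predPoly α m * invert (predPoly α m))) with hw
    -- The geometric sum identity G(1 - N) = 1 - N^m with 1 - N = p p*/B, multiplied by T j. Pairing
    -- it with γ expresses γ j through G and the nearly orthogonal quantities w.
    have e1 : (T j : ℝ[T;T⁻¹]) = C B⁻¹ * (T j * (G * (predPoly α m * invert (predPoly α m)))) +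
        T j * defect α B m ^ m := by
      have := mul_neg_geom_sum (defect α B m) m
      rw [← hGdef] at this
      have h2 : (1 : ℝ[T;T⁻¹]) - defect α B m =
          C B⁻¹ * (predPoly α m * invert (predPoly α m)) := by rw [defect]; ring
      rw [h2] at this
      linear_combination (-T j) * this
    have e2 : pairing γ (T j * (G * (predPoly α m * invert (predPoly α m)))) =
        pairing (fun l => w (j + l)) G := by
      conv_lhs => rw [eq_sum_C_mul_T G]
      rw [pairing_apply _ G, Finset.sum_mul, Finset.mul_sum, map_sum]
      refine Finset.sum_congr rfl fun l _ => ?_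
      rw [hw, mul_assoc, mul_left_comm, pairing_C_mul, ← mul_assoc, ← T_add]
    have e3 : pairing (fun l : ℤ => if j + l = 0 then (1 : ℝ) else 0) G = G.coeff (-j) := by
      rw [pairing_apply]
      simp only [add_eq_zero_iff_neg_eq, mul_ite, mul_one, mul_zero, Finset.sum_ite_eq,
        Finsupp.mem_support_iff, ne_eq, ite_not]
      split_ifs with h0 <;> simp [h0]
    have e4 : |pairing (fun l => w (j + l)) G - G.coeff (-j)| ≤ S * (B * τ m) := by
      have hlin : pairing (fun l => w (j + l)) G -
          pairing (fun l : ℤ => if j + l = 0 then (1 : ℝ) else 0) G =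
          pairing (fun l => w (j + l) - if j + l = 0 then (1 : ℝ) else 0) G := by
        simp only [pairing_apply, ← Finset.sum_sub_distrib, mul_sub]
      rw [← e3, hlin]
      refine (abs_pairing_le (b := B * τ m) (fun l => ?_) G).trans ?_
      · exact abs_pairing_predPoly_sub_le hγ hB (fun k => (h k).1) hs horth m (j + l)
      · have : 0 ≤ τ m := tsum_nonneg fun _ => coeffNorm_nonneg _
        exact mul_le_mul_of_nonneg_right (hG m hm) (by positivity)
    have e5 : |pairing γ (T j * defect α B m ^ m)| ≤ A * θ ^ m := by
      refine (abs_pairing_le hγ _).trans ?_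
      rw [mul_one, coeffNorm_T_mul]
      exact hN m hm m
    have e6 : γ j = B⁻¹ * pairing (fun l => w (j + l)) G + pairing γ (T j * defect α B m ^ m) := by
      rw [← e2, ← pairing_C_mul, ← map_add, ← e1, pairing_T]
    have hBi : B⁻¹ ≤ 1 := inv_le_one_of_one_le₀ hB
    have e7 : |pairing (fun l => w (j + l)) G| ≤ |G.coeff (-j)| + S * (B * τ m) := by
      have := abs_sub_abs_le_abs_sub (pairing (fun l => w (j + l)) G) (G.coeff (-j))
      linarith
    rw [e6]
    refine (abs_add_le _ _).trans ?_
    rw [abs_mul, abs_of_pos (inv_pos.2 hB0)]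
    have := mul_le_mul_of_nonneg_right hBi (abs_nonneg (pairing (fun l => w (j + l)) G))
    linarith
  refine summable_of_sum_le (c := S) (fun _ => abs_nonneg _) fun J => ?_
  -- For fixed finite J the errors vanish in the limit, leaving the bound S, which is independent of
  -- J.
  have hlim : Tendsto (fun m => S + J.card * (S * (B * τ m) + A * θ ^ m)) atTop
      (𝓝 (S + J.card * (S * (B * 0) + A * 0))) :=
    (((((hτ0.const_mul B).const_mul S).add
      ((tendsto_pow_atTop_nhds_zero_of_lt_one hθ0.le hθ1).const_mul A)).const_mul _).const_add _)
  have : S + J.card * (S * (B * 0) + A * 0) = S := by ring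
  rw [this] at hlim
  refine ge_of_tendsto hlim (eventually_atTop.2 ⟨M, fun m hm => ?_⟩)
  refine (Finset.sum_le_sum fun j _ => hpt m hm j).trans ?_
  rw [Finset.sum_add_distrib, Finset.sum_const, nsmul_eq_mul]
  gcongr
  refine le_trans ?_ (hG m hm)
  have := sum_abs_coeff_le (∑ i ∈ Finset.range m, defect α B m ^ i)
    (J.map (Equiv.neg ℤ).toEmbedding)
  simpa [Finset.sum_map] using this

end

/-! ### A summable majorant for the covariances with prediction errors -/

section

variable {α : ℕ → ℝ}

lemma sum_abs_pairing_shift_le {γ : ℤ → ℝ} (hγ : Summable fun j => |γ j|) (f : ℝ[T;T⁻¹])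
    (J : Finset ℕ) :
    ∑ j ∈ J, |pairing (fun i => γ (i + (j : ℤ))) f| ≤ coeffNorm f * ∑' i, |γ i| := by
  have h : ∀ j ∈ J, |pairing (fun i => γ (i + (j : ℤ))) f| ≤
      ∑ i ∈ f.coeff.support, |f.coeff i| * |γ (i + (j : ℤ))| := fun j _ => by
    rw [pairing_apply]
    exact (Finset.abs_sum_le_sum_abs _ _).trans_eq (Finset.sum_congr rfl fun i _ => abs_mul _ _)
  refine (Finset.sum_le_sum h).trans ?_
  rw [Finset.sum_comm, coeffNorm, Finset.sum_mul]
  refine Finset.sum_le_sum fun i _ => ?_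
  rw [← Finset.mul_sum]
  refine mul_le_mul_of_nonneg_left ?_ (abs_nonneg _)
  have hinj : Function.Injective fun j : ℕ => i + (j : ℤ) := fun a b hab => by simpa using hab
  have := hγ.sum_le_tsum (J.map ⟨_, hinj⟩) fun _ _ => abs_nonneg _
  rwa [Finset.sum_map] at this

/-- The inner products of a variable with all earlier prediction errors of all orders have an
absolutely summable majorant. -/
theorem exists_summable_bound_pairing_predPoly (hα : ∀ k, 1 ≤ k → |α k| < 1)
    (hsum : Summable fun k : ℕ => |α (k + 1)|) {γ : ℤ → ℝ} (hγ : ∀ j, |γ j| ≤ 1)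
    (horth : ∀ i j : ℕ, pairing γ (T ((j : ℤ) - i) * (predPoly α i * invert (predPoly α j))) =
      if i = j then 1 else 0) :
    ∃ Ψ : ℕ → ℝ, (∀ j, 0 ≤ Ψ j) ∧ Summable Ψ ∧
      ∀ (m j : ℕ), |pairing (fun i => γ (i + (j : ℤ))) (predPoly α m)| ≤ Ψ j := by
  have hγs := summable_abs_autocorrelation hα hsum hγ horth
  have hs := summable_coeffNorm_predPoly_sub hα hsum
  set d : ℕ → ℝ[T;T⁻¹] := fun k => predPoly α (k + 1) - predPoly α k with hd
  set F : ℕ × ℕ → ℝ := fun x => |pairing (fun i => γ (i + (x.2 : ℤ))) (d x.1)| with hF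
  have hF0 : 0 ≤ F := fun _ => abs_nonneg _
  have hrow : ∀ k, Summable fun j => F (k, j) := fun k =>
    summable_of_sum_le (fun _ => abs_nonneg _) fun J => sum_abs_pairing_shift_le hγs (d k) J
  -- Summing over lags first gives at most the ℓ¹ norm of p_{k+1} - p_k times that of γ. Exchanging
  -- the sums then permits a majorant at each lag that covers all orders.
  have hFs : Summable F := by
    rw [summable_prod_of_nonneg hF0]
    refine ⟨hrow, Summable.of_nonneg_of_le (fun k => tsum_nonneg fun _ => abs_nonneg _)
      (fun k => ?_) (hs.mul_right (∑' i, |γ i|))⟩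
    exact (hrow k).tsum_le_of_sum_le fun J => sum_abs_pairing_shift_le hγs (d k) J
  have hcol := hFs.prod_symm
  refine ⟨fun j => |γ j| + ∑' k, F (k, j),
    fun j => add_nonneg (abs_nonneg _) (tsum_nonneg fun _ => abs_nonneg _), ?_, fun m j => ?_⟩
  · exact (hγs.comp_injective Nat.cast_injective).add hcol.prod
  · have e : predPoly α m = 1 + ∑ k ∈ Finset.range m, d k := by
      rw [Finset.sum_range_sub, predPoly_zero]
      ring
    rw [e, map_add, pairing_one, map_sum]
    refine (abs_add_le _ _).trans (add_le_add (by simp) ?_)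
    refine (Finset.abs_sum_le_sum_abs _ _).trans ?_
    exact (hcol.prod_factor j).sum_le_tsum _ fun _ _ => abs_nonneg _

end

/-! ### The standard normal distribution function and its inverse -/

/-- The standard normal distribution function. -/
def normalCdf (x : ℝ) : ℝ := cdf (gaussianReal 0 1) x

/-- The standard normal density. -/
def normalPdf (x : ℝ) : ℝ := gaussianPDFReal 0 1 x

lemma normalPdf_pos (x : ℝ) : 0 < normalPdf x := gaussianPDFReal_pos 0 1 x one_ne_zero

lemma continuous_normalPdf : Continuous normalPdf := by
  have : normalPdf = fun x => gaussianPDFReal 0 1 x := rfl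
  rw [this]
  unfold gaussianPDFReal
  fun_prop

lemma normalCdf_eq_integral (x : ℝ) : normalCdf x = ∫ s in Iic x, normalPdf s := by
  rw [normalCdf, cdf_eq_real, measureReal_def, gaussianReal_apply_eq_integral 0 one_ne_zero,
    ENNReal.toReal_ofReal (integral_nonneg fun s => gaussianPDFReal_nonneg 0 1 s)]
  rfl

lemma hasDerivAt_integral_Iic {f : ℝ → ℝ} (hf : Continuous f) (hi : Integrable f) (x : ℝ) :
    HasDerivAt (fun a => ∫ s in Iic a, f s) (f x) x := by
  have h := intervalIntegral.integral_hasDerivAt_right (hf.intervalIntegrable 0 x)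
    (hf.stronglyMeasurableAtFilter _ _) hf.continuousAt
  have e : (fun a => ∫ s in Iic a, f s) =
      fun a => (∫ s in (0 : ℝ)..a, f s) + ∫ s in Iic 0, f s := by
    ext a
    rw [← intervalIntegral.integral_Iic_sub_Iic hi.integrableOn hi.integrableOn, sub_add_cancel]
  rw [e]
  exact h.add_const _

lemma integrable_normalPdf : Integrable normalPdf := integrable_gaussianPDFReal 0 1

lemma hasDerivAt_normalCdf (x : ℝ) : HasDerivAt normalCdf (normalPdf x) x := by
  have : normalCdf = fun a => ∫ s in Iic a, normalPdf s := funext normalCdf_eq_integral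
  rw [this]
  exact hasDerivAt_integral_Iic continuous_normalPdf integrable_normalPdf x

lemma continuous_normalCdf : Continuous normalCdf :=
  continuous_iff_continuousAt.2 fun x => (hasDerivAt_normalCdf x).continuousAt

lemma strictMono_normalCdf : StrictMono normalCdf :=
  strictMono_of_deriv_pos fun x => by
    rw [(hasDerivAt_normalCdf x).deriv]
    exact normalPdf_pos x

lemma normalCdf_mem_Ioo (x : ℝ) : normalCdf x ∈ Ioo (0 : ℝ) 1 :=
  ⟨(cdf_nonneg _ (x - 1)).trans_lt (strictMono_normalCdf (by linarith)),
    (strictMono_normalCdf (show x < x + 1 by linarith)).trans_le (cdf_le_one _ _)⟩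

lemma normalQuantile_normalCdf (x : ℝ) : normalQuantile (normalCdf x) = x := by
  have : {y : ℝ | normalCdf x ≤ cdf (gaussianReal 0 1) y} = Ici x := by
    ext y
    exact strictMono_normalCdf.le_iff_le
  rw [normalQuantile, this, csInf_Ici]

lemma exists_normalCdf_eq {u : ℝ} (hu : u ∈ Ioo (0 : ℝ) 1) : ∃ x, normalCdf x = u := by
  have h := mem_range_of_exists_le_of_exists_ge continuous_normalCdf
    (c := u) ?_ ?_
  · exact h
  · exact (((tendsto_cdf_atBot (gaussianReal 0 1)).eventually (gt_mem_nhds hu.1)).exists).imp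
      fun _ h => le_of_lt h
  · exact (((tendsto_cdf_atTop (gaussianReal 0 1)).eventually (lt_mem_nhds hu.2)).exists).imp
      fun _ h => le_of_lt h

lemma normalCdf_normalQuantile {u : ℝ} (hu : u ∈ Ioo (0 : ℝ) 1) :
    normalCdf (normalQuantile u) = u := by
  obtain ⟨x, rfl⟩ := exists_normalCdf_eq hu
  rw [normalQuantile_normalCdf]

lemma strictMonoOn_normalQuantile : StrictMonoOn normalQuantile (Ioo 0 1) := by
  intro u hu v hv huv
  rw [← strictMono_normalCdf.lt_iff_lt, normalCdf_normalQuantile hu, normalCdf_normalQuantile hv]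
  exact huv

lemma continuousAt_normalQuantile (x : ℝ) : ContinuousAt normalQuantile (normalCdf x) := by
  have hmem : Ioo (0 : ℝ) 1 ∈ 𝓝 (normalCdf x) := Ioo_mem_nhds (normalCdf_mem_Ioo x).1
    (normalCdf_mem_Ioo x).2
  refine strictMonoOn_normalQuantile.continuousAt_of_image_mem_nhds hmem ?_
  have : normalQuantile '' Ioo 0 1 = univ := by
    refine eq_univ_of_forall fun y => ⟨normalCdf y, normalCdf_mem_Ioo y, normalQuantile_normalCdf y⟩
  rw [this]
  exact univ_mem

lemma hasDerivAt_normalQuantile (x : ℝ) :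
    HasDerivAt normalQuantile (normalPdf x)⁻¹ (normalCdf x) := by
  have hmem : Ioo (0 : ℝ) 1 ∈ 𝓝 (normalCdf x) := Ioo_mem_nhds (normalCdf_mem_Ioo x).1
    (normalCdf_mem_Ioo x).2
  refine HasDerivAt.of_local_left_inverse (f := normalCdf) (continuousAt_normalQuantile x) ?_
    (normalPdf_pos x).ne' ?_
  · rw [normalQuantile_normalCdf]
    exact hasDerivAt_normalCdf x
  · filter_upwards [hmem] with u hu using normalCdf_normalQuantile hu

/-! ### The bivariate normal law -/

open Complex in
lemma charFun_map_linear (a b c d : ℝ) (t : EuclideanSpace ℝ (Fin 2)) :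
    charFun (((gaussianReal 0 1).prod (gaussianReal 0 1)).map
      fun p : ℝ × ℝ => (!₂[a * p.1 + b * p.2, c * p.1 + d * p.2] : EuclideanSpace ℝ (Fin 2))) t =
      cexp (-(((a * t 0 + c * t 1) ^ 2 + (b * t 0 + d * t 1) ^ 2 : ℝ) : ℂ) / 2) := by
  have hm : Measurable fun p : ℝ × ℝ =>
      (!₂[a * p.1 + b * p.2, c * p.1 + d * p.2] : EuclideanSpace ℝ (Fin 2)) := by
    fun_prop
  have h1 := charFun_gaussianReal (μ := 0) (v := 1) (a * t 0 + c * t 1)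
  have h2 := charFun_gaussianReal (μ := 0) (v := 1) (b * t 0 + d * t 1)
  rw [charFun_apply_real] at h1 h2
  rw [charFun_apply, integral_map hm.aemeasurable (by fun_prop)]
  have e : ∀ p : ℝ × ℝ, cexp ((inner ℝ (!₂[a * p.1 + b * p.2, c * p.1 + d * p.2] :
      EuclideanSpace ℝ (Fin 2)) t : ℝ) * I) =
      cexp ((a * t 0 + c * t 1 : ℝ) * p.1 * I) * cexp ((b * t 0 + d * t 1 : ℝ) * p.2 * I) := by
    intro p
    rw [← Complex.exp_add]
    congr 1
    simp [PiLp.inner_apply, Fin.sum_univ_two]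
    ring
  simp only [e]
  rw [integral_prod_mul (fun x : ℝ => cexp ((a * t 0 + c * t 1 : ℝ) * x * I))
    (fun x : ℝ => cexp ((b * t 0 + d * t 1 : ℝ) * x * I)), h1, h2, ← Complex.exp_add]
  congr 1
  push_cast
  ring

lemma posSemidef_correlation {ρ : ℝ} (hρ : |ρ| < 1) :
    (!![1, ρ; ρ, 1] : Matrix (Fin 2) (Fin 2) ℝ).PosSemidef := by
  refine Matrix.PosSemidef.of_dotProduct_mulVec_nonneg ?_ fun x => ?_
  · ext i j
    fin_cases i <;> fin_cases j <;> simp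
  · have := (sq_lt_one_iff_abs_lt_one ρ).2 hρ
    simp [Matrix.mulVec, dotProduct, Fin.sum_univ_two]
    nlinarith [sq_nonneg (x 0 + ρ * x 1), sq_nonneg (x 1)]

/-- Both laws have the same characteristic function. The factor of the correlation matrix is left
free: one triangular choice conditions on the first coordinate, the mirrored one yields symmetry of
the copula. -/
lemma multivariateGaussian_eq_map {ρ a b c d : ℝ} (hρ : |ρ| < 1) (h1 : a ^ 2 + b ^ 2 = 1)
    (h2 : c ^ 2 + d ^ 2 = 1) (h3 : a * c + b * d = ρ) :
    multivariateGaussian (0 : EuclideanSpace ℝ (Fin 2)) !![1, ρ; ρ, 1] =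
      ((gaussianReal 0 1).prod (gaussianReal 0 1)).map
        fun p : ℝ × ℝ => (!₂[a * p.1 + b * p.2, c * p.1 + d * p.2] : EuclideanSpace ℝ (Fin 2)) := by
  have hm : Measurable fun p : ℝ × ℝ =>
      (!₂[a * p.1 + b * p.2, c * p.1 + d * p.2] : EuclideanSpace ℝ (Fin 2)) := by
    fun_prop
  have := Measure.isProbabilityMeasure_map (μ := (gaussianReal 0 1).prod (gaussianReal 0 1))
    hm.aemeasurable
  refine Measure.ext_of_charFun (funext fun t => ?_)
  rw [charFun_map_linear, charFun_multivariateGaussian (posSemidef_correlation hρ)]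
  congr 1
  have : (a * t 0 + c * t 1) ^ 2 + (b * t 0 + d * t 1) ^ 2 =
      t 0 ^ 2 + 2 * ρ * (t 0 * t 1) + t 1 ^ 2 := by
    rw [← h3]
    linear_combination t 0 ^ 2 * h1 + t 1 ^ 2 * h2
  rw [this]
  simp [Matrix.mulVec, dotProduct, Fin.sum_univ_two]
  ring

/-! ### Derivatives of the Gaussian copula -/

lemma gaussian_prod_real_eq_integral {ρ r : ℝ} (hr : 0 < r) (a b : ℝ) :
    ((gaussianReal 0 1).prod (gaussianReal 0 1)).real
      {p : ℝ × ℝ | p.1 ≤ a ∧ ρ * p.1 + r * p.2 ≤ b} =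
      ∫ s in Iic a, normalPdf s * normalCdf ((b - ρ * s) / r) := by
  have hm : MeasurableSet {p : ℝ × ℝ | p.1 ≤ a ∧ ρ * p.1 + r * p.2 ≤ b} := by
    rw [ofPred_and]
    exact (measurableSet_le (by fun_prop) (by fun_prop)).inter
      (measurableSet_le (by fun_prop) (by fun_prop))
  have hslice : ∀ s, (gaussianReal 0 1 (Prod.mk s ⁻¹'
      {p : ℝ × ℝ | p.1 ≤ a ∧ ρ * p.1 + r * p.2 ≤ b})).toReal =
      (Iic a).indicator (fun s => normalCdf ((b - ρ * s) / r)) s := by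
    intro s
    by_cases hs : s ≤ a
    · rw [indicator_of_mem (mem_Iic.2 hs), normalCdf, cdf_eq_real, measureReal_def]
      congr 2
      ext w
      simp only [mem_preimage, mem_ofPred_eq, hs, true_and, mem_Iic]
      rw [le_div_iff₀ hr]
      constructor <;> intro h <;> linarith
    · rw [indicator_of_notMem (by simpa using hs)]
      have : Prod.mk s ⁻¹' {p : ℝ × ℝ | p.1 ≤ a ∧ ρ * p.1 + r * p.2 ≤ b} = ∅ := by
        ext w
        simp [hs]
      rw [this]
      simp
  rw [measureReal_def, Measure.prod_apply hm,
    ← integral_toReal (measurable_measure_prodMk_left hm).aemeasurable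
      (Eventually.of_forall fun s => measure_lt_top _ _)]
  simp only [hslice]
  rw [integral_gaussianReal_eq_integral_smul one_ne_zero, ← integral_indicator measurableSet_Iic]
  refine integral_congr_ae (Eventually.of_forall fun s => ?_)
  by_cases hs : s ∈ Iic a
  · simp [hs, normalPdf]
  · simp [hs]

lemma sqrt_one_sub_sq_pos {ρ : ℝ} (hρ : |ρ| < 1) : 0 < √(1 - ρ ^ 2) := by
  have := (sq_lt_one_iff_abs_lt_one ρ).2 hρ
  exact Real.sqrt_pos.2 (by linarith)

lemma sq_sqrt_one_sub_sq {ρ : ℝ} (hρ : |ρ| < 1) : √(1 - ρ ^ 2) ^ 2 = 1 - ρ ^ 2 := by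
  have := (sq_lt_one_iff_abs_lt_one ρ).2 hρ
  exact Real.sq_sqrt (by linarith)

lemma measurableSet_quadrant (a b : ℝ) :
    MeasurableSet {x : EuclideanSpace ℝ (Fin 2) | x 0 ≤ a ∧ x 1 ≤ b} := by
  rw [ofPred_and]
  exact (measurableSet_le (by fun_prop) (by fun_prop)).inter
    (measurableSet_le (by fun_prop) (by fun_prop))

lemma gaussianCopula_eq_integral {ρ : ℝ} (hρ : |ρ| < 1) (u v : ℝ) :
    gaussianCopula ρ u v = ∫ s in Iic (normalQuantile u),
      normalPdf s * normalCdf ((normalQuantile v - ρ * s) / √(1 - ρ ^ 2)) := by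
  have hm : Measurable fun p : ℝ × ℝ => (!₂[1 * p.1 + 0 * p.2, ρ * p.1 + √(1 - ρ ^ 2) * p.2] :
      EuclideanSpace ℝ (Fin 2)) := by fun_prop
  rw [gaussianCopula, multivariateGaussian_eq_map (a := 1) (b := 0) (c := ρ)
    (d := √(1 - ρ ^ 2)) hρ (by norm_num) (by rw [sq_sqrt_one_sub_sq hρ]; ring) (by ring),
    ← gaussian_prod_real_eq_integral (sqrt_one_sub_sq_pos hρ), measureReal_def,
    Measure.map_apply hm (measurableSet_quadrant _ _), measureReal_def]
  congr 2
  ext p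
  simp

lemma gaussianCopula_comm {ρ : ℝ} (hρ : |ρ| < 1) (u v : ℝ) :
    gaussianCopula ρ u v = gaussianCopula ρ v u := by
  have hm : Measurable fun p : ℝ × ℝ => (!₂[ρ * p.1 + √(1 - ρ ^ 2) * p.2, 1 * p.1 + 0 * p.2] :
      EuclideanSpace ℝ (Fin 2)) := by fun_prop
  rw [gaussianCopula_eq_integral hρ v u, ← gaussian_prod_real_eq_integral (sqrt_one_sub_sq_pos hρ),
    gaussianCopula, multivariateGaussian_eq_map (c := 1) (d := 0) (a := ρ)
    (b := √(1 - ρ ^ 2)) hρ (by rw [sq_sqrt_one_sub_sq hρ]; ring) (by norm_num) (by ring),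
    measureReal_def, Measure.map_apply hm (measurableSet_quadrant _ _), measureReal_def]
  congr 2
  ext p
  simp [and_comm]

/-- The chain rule multiplies the integrand φ(x)Φ(…) by the derivative 1/φ(x) of the quantile
function. The argument v stays free because the density requires a further derivative in v. -/
lemma hFst_gaussianCopula {ρ : ℝ} (hρ : |ρ| < 1) (x v : ℝ) :
    hFst (gaussianCopula ρ) (normalCdf x) v =
      normalCdf ((normalQuantile v - ρ * x) / √(1 - ρ ^ 2)) := by
  set f : ℝ → ℝ := fun s => normalPdf s * normalCdf ((normalQuantile v - ρ * s) / √(1 - ρ ^ 2))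
    with hf
  have hc : Continuous fun s : ℝ => normalCdf ((normalQuantile v - ρ * s) / √(1 - ρ ^ 2)) :=
    continuous_normalCdf.comp (by fun_prop)
  have hfc : Continuous f := continuous_normalPdf.mul hc
  have hfi : Integrable f := by
    refine integrable_normalPdf.mul_bdd (c := 1) hc.aestronglyMeasurable
      (Eventually.of_forall fun s => ?_)
    rw [Real.norm_eq_abs, abs_of_pos (normalCdf_mem_Ioo _).1]
    exact (normalCdf_mem_Ioo _).2.le
  have h1 : HasDerivAt (fun a => ∫ s in Iic a, f s) (f x) (normalQuantile (normalCdf x)) := by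
    rw [normalQuantile_normalCdf]
    exact hasDerivAt_integral_Iic hfc hfi x
  have h2 := h1.comp _ (hasDerivAt_normalQuantile x)
  have h3 : (fun u => gaussianCopula ρ u v) = (fun a => ∫ s in Iic a, f s) ∘ normalQuantile :=
    funext fun u => gaussianCopula_eq_integral hρ u v
  rw [hFst, h3, h2.deriv, hf]
  have := (normalPdf_pos x).ne'
  field_simp

lemma hFst_gaussianCopula_normalCdf {ρ : ℝ} (hρ : |ρ| < 1) (x y : ℝ) :
    hFst (gaussianCopula ρ) (normalCdf x) (normalCdf y) =
      normalCdf ((y - ρ * x) / √(1 - ρ ^ 2)) := by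
  rw [hFst_gaussianCopula hρ, normalQuantile_normalCdf]

lemma hSnd_gaussianCopula_normalCdf {ρ : ℝ} (hρ : |ρ| < 1) (x y : ℝ) :
    hSnd (gaussianCopula ρ) (normalCdf x) (normalCdf y) =
      normalCdf ((x - ρ * y) / √(1 - ρ ^ 2)) := by
  rw [← hFst_gaussianCopula_normalCdf hρ, hSnd, hFst]
  congr 1
  exact funext fun v => gaussianCopula_comm hρ _ _

lemma pairDensity_gaussianCopula_normalCdf {ρ : ℝ} (hρ : |ρ| < 1) (x y : ℝ) :
    pairDensity (gaussianCopula ρ) (normalCdf x) (normalCdf y) =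
      normalPdf ((y - ρ * x) / √(1 - ρ ^ 2)) / (√(1 - ρ ^ 2) * normalPdf y) := by
  have h1 : (fun v => hFst (gaussianCopula ρ) (normalCdf x) v) =
      fun v => normalCdf ((normalQuantile v - ρ * x) / √(1 - ρ ^ 2)) :=
    funext fun v => hFst_gaussianCopula hρ x v
  have h2 : HasDerivAt (fun v => (normalQuantile v - ρ * x) / √(1 - ρ ^ 2))
      ((normalPdf y)⁻¹ / √(1 - ρ ^ 2)) (normalCdf y) :=
    ((hasDerivAt_normalQuantile y).sub_const _).div_const _
  have h3 : HasDerivAt normalCdf (normalPdf ((y - ρ * x) / √(1 - ρ ^ 2)))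
      ((normalQuantile (normalCdf y) - ρ * x) / √(1 - ρ ^ 2)) := by
    rw [normalQuantile_normalCdf]
    exact hasDerivAt_normalCdf _
  have h4 : HasDerivAt (fun v => normalCdf ((normalQuantile v - ρ * x) / √(1 - ρ ^ 2))) _ _ :=
    h3.comp (normalCdf y) h2
  rw [pairDensity, h1, h4.deriv]
  have := (normalPdf_pos y).ne'
  have := (sqrt_one_sub_sq_pos hρ).ne'
  field_simp

section

/-! ### Prediction errors and the Rosenblatt functions -/

/-- The normalized error of predicting `x_t` from `x_{t-k}, …, x_{t-1}`. -/
def predError (α : ℕ → ℝ) (k : ℕ) (x : ℤ → ℝ) (t : ℤ) : ℝ :=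
  pairing (fun j => x (t - j)) (predPoly α k)

/-- The normalized error of predicting `x_t` from `x_{t+1}, …, x_{t+k}`. -/
def backError (α : ℕ → ℝ) (k : ℕ) (x : ℤ → ℝ) (t : ℤ) : ℝ :=
  pairing (fun j => x (t + k - j)) (backPoly α k)

variable (α : ℕ → ℝ)

lemma predError_zero (x : ℤ → ℝ) (t : ℤ) : predError α 0 x t = x t := by
  rw [predError, predPoly_zero, pairing_one, sub_zero]

lemma backError_zero (x : ℤ → ℝ) (t : ℤ) : backError α 0 x t = x t := by
  rw [backError, backPoly_zero, pairing_one]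
  simp

lemma predError_succ (k : ℕ) (x : ℤ → ℝ) (t : ℤ) : predError α (k + 1) x t =
    (predError α k x t - α (k + 1) * backError α k x (t - k - 1)) / √(1 - α (k + 1) ^ 2) := by
  rw [predError, predPoly_succ, pairing_C_mul, map_sub, pairing_C_mul, pairing_T_mul, predError,
    backError, div_eq_inv_mul]
  congr 5
  ext j
  congr 1
  ring

lemma backError_succ (k : ℕ) (x : ℤ → ℝ) (t : ℤ) : backError α (k + 1) x t =
    (backError α k x t - α (k + 1) * predError α k x (t + k + 1)) / √(1 - α (k + 1) ^ 2) := by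
  rw [backError, backPoly_succ, pairing_C_mul, map_sub, pairing_C_mul, pairing_T_mul, predError,
    backError, div_eq_inv_mul]
  push_cast
  congr 3
  · congr 1
    ext j
    congr 1
    ring
  · congr 2
    ext j
    congr 1
    ring

lemma predError_eq_sum (k n : ℕ) (hkn : k < n) (x : ℤ → ℝ) (a : ℤ) :
    predError α k x (a + k) =
      ∑ l : Fin n, (predPoly α k).coeff ((k : ℤ) - l) * x (a + l) := by
  have hinj : Function.Injective fun l : Fin n => (k : ℤ) - l := fun l m h => by
    ext
    simp only [sub_right_inj, Nat.cast_inj] at h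
    exact h
  rw [predError, pairing_eq_sum _ _ (s := Finset.univ.map ⟨_, hinj⟩), Finset.sum_map]
  · refine Finset.sum_congr rfl fun l _ => ?_
    simp only [Function.Embedding.coeFn_mk]
    congr 2
    ring
  · refine (support_predPoly α k).trans fun j hj => ?_
    rw [Finset.mem_Icc] at hj
    refine Finset.mem_map.2 ⟨⟨k - j.toNat, by omega⟩, Finset.mem_univ _, ?_⟩
    simp only [Function.Embedding.coeFn_mk]
    omega

/-- The error is affine in the current value, with slope the constant coefficient of the prediction
polynomial. Positivity of the slope makes R_k invertible in its last argument. -/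
lemma predError_update (k : ℕ) (x : ℤ → ℝ) (t : ℤ) (v : ℝ) :
    predError α k (Function.update x t v) t =
      predError α k x t + (predPoly α k).coeff 0 * (v - x t) := by
  rw [predError, predError, pairing_eq_sum _ _ (support_predPoly α k),
    pairing_eq_sum _ _ (support_predPoly α k), ← sub_eq_iff_eq_add', ← Finset.sum_sub_distrib,
    Finset.sum_eq_single 0]
  · simp
    ring
  · intro j _ hj
    rw [Function.update_of_ne (by omega)]
    ring
  · intro h
    simp at h

variable {α}

/-- On normal scores the Gaussian h-functions perform exactly one Levinson step. The two claims need
a joint induction: the forward error at t and the backward error at t - k - 1 share the window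
between them. -/
lemma rosenblatt_gaussian (hα : ∀ k, 1 ≤ k → |α k| < 1) (k : ℕ) :
    (∀ (z : ℤ → ℝ) (t : ℤ), rosenblatt (fun k => gaussianCopula (α k)) k
      (fun i => normalCdf (z (t - k + i.val))) (normalCdf (z t)) =
        normalCdf (predError α k z t)) ∧
    (∀ (z : ℤ → ℝ) (t : ℤ), rosenblattBack (fun k => gaussianCopula (α k)) k
      (fun i => normalCdf (z (t + 1 + i.val))) (normalCdf (z t)) =
        normalCdf (backError α k z t)) := by
  induction k with
  | zero =>
    constructor <;> intro z t
    · rw [predError_zero]; rfl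
    · rw [backError_zero]; rfl
  | succ k ih =>
    have hk := hα (k + 1) (by omega)
    constructor <;> intro z t
    · have h1 : Fin.tail (fun i : Fin (k + 1) => normalCdf (z (t - ((k + 1 : ℕ) : ℤ) + i.val))) =
          fun i : Fin k => normalCdf (z (t - k + i.val)) := by
        ext i
        simp only [Fin.tail, Fin.val_succ]
        congr 2
        push_cast
        ring
      have h2 : (fun i : Fin k => normalCdf (z (t - k + i.val))) =
          fun i : Fin k => normalCdf (z ((t - k - 1) + 1 + i.val)) := by
        ext i
        congr 2
        ring
      have h3 : normalCdf (z (t - ((k + 1 : ℕ) : ℤ) + (0 : Fin (k + 1)).val)) =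
          normalCdf (z (t - k - 1)) := by
        congr 2
        push_cast
        simp
        ring
      have h4 := ih.1 z t
      have h5 := ih.2 z (t - k - 1)
      rw [← h2] at h5
      simp only [rosenblatt, rosenblattBack] at h4 h5 ⊢
      rw [rosenblattPair, h1, h3, h4, h5]
      simp only
      rw [hFst_gaussianCopula_normalCdf hk, predError_succ]
    · have h1 : Fin.init (fun i : Fin (k + 1) => normalCdf (z (t + 1 + i.val))) =
          fun i : Fin k => normalCdf (z (t + 1 + i.val)) := by
        ext i
        simp [Fin.init]
      have h2 : (fun i : Fin k => normalCdf (z (t + 1 + i.val))) =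
          fun i : Fin k => normalCdf (z ((t + k + 1) - k + i.val)) := by
        ext i
        congr 2
        ring
      have h3 : normalCdf (z (t + 1 + (Fin.last k).val)) = normalCdf (z (t + k + 1)) := by
        congr 2
        simp
        ring
      have h4 := ih.1 z (t + k + 1)
      have h5 := ih.2 z t
      rw [← h2] at h4
      simp only [rosenblatt, rosenblattBack] at h4 h5 ⊢
      rw [rosenblattPair, h1, h3, h4, h5]
      simp only
      rw [hSnd_gaussianCopula_normalCdf hk, backError_succ]

lemma rosenblattInv_gaussian (hα : ∀ k, 1 ≤ k → |α k| < 1) (k : ℕ) (y : ℤ → ℝ) (t : ℤ) :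
    rosenblattInv (fun k => gaussianCopula (α k)) k (fun i => normalCdf (y (t - k + i.val)))
      (normalCdf (predError α k y t)) = normalCdf (y t) := by
  have hval : ∀ v, rosenblatt (fun k => gaussianCopula (α k)) k
      (fun i => normalCdf (y (t - k + i.val))) (normalCdf v) =
      normalCdf (predError α k y t + (predPoly α k).coeff 0 * (v - y t)) := fun v => by
    rw [← predError_update, ← (rosenblatt_gaussian hα k).1]
    congr 1
    · ext i
      rw [Function.update_of_ne]
      omega
    · simp
  have hinj : InjOn (fun x => rosenblatt (fun k => gaussianCopula (α k)) k
      (fun i => normalCdf (y (t - k + i.val))) x) (Ioo 0 1) := by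
    intro u hu v hv huv
    obtain ⟨u, rfl⟩ := exists_normalCdf_eq hu
    obtain ⟨v, rfl⟩ := exists_normalCdf_eq hv
    simp only [hval] at huv
    have h1 := strictMono_normalCdf.injective huv
    have h2 := (coeff_predPoly_zero_pos hα k).ne'
    have h3 : (predPoly α k).coeff 0 * (u - v) = 0 := by linarith
    have h4 := (mul_eq_zero.1 h3).resolve_left h2
    rw [sub_eq_zero.1 h4]
  have := hinj.leftInvOn_invFunOn (normalCdf_mem_Ioo (y t))
  rw [rosenblattInv, ← (rosenblatt_gaussian hα k).1 y t]
  exact this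

/-- The hypothesis is a triangular system for y with right-hand side w. The recursion for S_k is its
forward substitution: earlier values are known by induction, and one inversion gives the last. -/
lemma rosenblattS_gaussian (hα : ∀ k, 1 ≤ k → |α k| < 1) (w y : ℤ → ℝ) (a : ℤ) (k : ℕ)
    (h : ∀ i : ℕ, i ≤ k → predError α i y (a + i) = w (a + i)) :
    rosenblattS (fun k => gaussianCopula (α k)) k (fun i => normalCdf (w (a + i.val)))
      (normalCdf (w (a + k))) = normalCdf (y (a + k)) := by
  induction k using Nat.strong_induction_on with
  | _ k ih =>
    rcases k with _ | k
    · have := h 0 le_rfl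
      rw [predError_zero] at this
      rw [rosenblattS, this]
    · rw [rosenblattS]
      have h1 : (fun i : Fin (k + 1) => rosenblattS (fun k => gaussianCopula (α k)) i.val
          (fun j : Fin i.val => normalCdf (w (a + ((j.val : ℕ) : ℤ))))
          (normalCdf (w (a + i.val)))) =
          fun i : Fin (k + 1) =>
            normalCdf (y ((a + ((k + 1 : ℕ) : ℤ)) - ((k + 1 : ℕ) : ℤ) + i.val)) := by
        ext i
        rw [ih i.val i.isLt fun j hj => h j (hj.trans i.isLt.le)]
        congr 2
        ring
      rw [h1, ← h (k + 1) le_rfl, rosenblattInv_gaussian hα]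

end

section

/-! ### The density in Gaussian scale -/

variable {α : ℕ → ℝ}

/-- Factors indexed by lag and left end are regrouped by right end, so that each time point collects
its conditional density. -/
lemma prod_triangle {M : Type*} [CommMonoid M] (n : ℕ) (g : ℕ → ℕ → M) :
    ∏ k : Fin (n - 1), ∏ i : Fin (n - 1 - k.val), g k.val (i.val + k.val + 1) =
      ∏ j : Fin n, ∏ k ∈ Finset.range j.val, g k j.val := by
  have h : ∀ k : Fin (n - 1), ∏ i : Fin (n - 1 - k.val), g k.val (i.val + k.val + 1) =
      ∏ i ∈ Finset.range (n - 1 - k.val), g k.val (i + k.val + 1) := fun k =>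
    (Finset.prod_range fun i => g k.val (i + k.val + 1)).symm
  simp only [h]
  rw [← Finset.prod_range fun k => ∏ i ∈ Finset.range (n - 1 - k), g k (i + k + 1),
    ← Finset.prod_range fun j => ∏ k ∈ Finset.range j, g k j, Finset.prod_sigma',
    Finset.prod_sigma']
  refine Finset.prod_bij' (fun x _ => ⟨x.2 + x.1 + 1, x.1⟩) (fun x _ => ⟨x.2, x.1 - x.2 - 1⟩)
    ?_ ?_ ?_ ?_ ?_
  · rintro ⟨a, b⟩ hab
    simp only [Finset.mem_sigma, Finset.mem_range] at hab ⊢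
    omega
  · rintro ⟨a, b⟩ hab
    simp only [Finset.mem_sigma, Finset.mem_range] at hab ⊢
    omega
  · rintro ⟨a, b⟩ hab
    simp only [Sigma.mk.injEq, heq_eq_eq, true_and]
    omega
  · rintro ⟨a, b⟩ hab
    simp only [Finset.mem_sigma, Finset.mem_range] at hab
    simp only [Sigma.mk.injEq, heq_eq_eq, and_true]
    omega
  · rintro ⟨a, b⟩ hab
    rfl

/-- The normal densities telescope in k, and the factors 1/√(1 - α²) multiply to the constant
coefficient. -/
lemma prod_pairDensity_eq (hα : ∀ k, 1 ≤ k → |α k| < 1) (z : ℤ → ℝ) (t : ℤ) (j : ℕ) :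
    ∏ k ∈ Finset.range j, normalPdf (predError α (k + 1) z t) /
      (√(1 - α (k + 1) ^ 2) * normalPdf (predError α k z t)) =
    (predPoly α j).coeff 0 * (normalPdf (predError α j z t) / normalPdf (z t)) := by
  induction j with
  | zero =>
    have := (normalPdf_pos (z t)).ne'
    rw [predError_zero, predPoly_zero, ← T_zero]
    simp [this]
  | succ j ih =>
    have h : (predPoly α (j + 1)).coeff 0 =
        (√(1 - α (j + 1) ^ 2))⁻¹ * (predPoly α j).coeff 0 := by
      rw [predPoly_succ, coeff_C_mul, AddMonoidAlgebra.coeff_sub, Finsupp.sub_apply, coeff_C_mul,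
        coeff_T_mul, coeff_backPoly, coeff_predPoly_eq_zero α j (j - (0 - 1)) (by omega)]
      ring
    rw [Finset.prod_range_succ, ih, h]
    have h1 := (normalPdf_pos (z t)).ne'
    have h2 := (normalPdf_pos (predError α j z t)).ne'
    have h3 := (Real.sqrt_pos.2 (one_sub_sq_pos hα j)).ne'
    field_simp

lemma svineDensity_gaussian (hα : ∀ k, 1 ≤ k → |α k| < 1) (n : ℕ) (z : ℤ → ℝ) :
    svineDensity (fun k => gaussianCopula (α k)) n (fun i => normalCdf (z i.val)) =
      ∏ j : Fin n, (predPoly α j.val).coeff 0 *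
        (normalPdf (predError α j.val z j.val) / normalPdf (z j.val)) := by
  have h1 := prod_triangle n fun k j => normalPdf (predError α (k + 1) z j) /
      (√(1 - α (k + 1) ^ 2) * normalPdf (predError α k z j))
  simp only [prod_pairDensity_eq hα] at h1
  rw [← h1, svineDensity]
  refine Finset.prod_congr rfl fun k _ => Finset.prod_congr rfl fun i _ => ?_
  have h2 := (rosenblatt_gaussian hα k.val).2 z i.val
  have h3 := (rosenblatt_gaussian hα k.val).1 z ((i.val + k.val + 1 : ℕ) : ℤ)
  have e1 : (fun m : Fin k.val => normalCdf (z ((i.val + 1 + m.val : ℕ) : ℤ))) =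
      fun m : Fin k.val => normalCdf (z ((i.val : ℤ) + 1 + m.val)) := by
    ext m; push_cast; rfl
  have e2 : (fun m : Fin k.val => normalCdf (z ((i.val + 1 + m.val : ℕ) : ℤ))) =
      fun m : Fin k.val => normalCdf (z (((i.val + k.val + 1 : ℕ) : ℤ) - k.val + m.val)) := by
    ext m; congr 2; push_cast; ring
  rw [← e1] at h2
  rw [← e2] at h3
  simp only
  rw [h2, h3, pairDensity_gaussianCopula_normalCdf (hα (k.val + 1) (by omega)), predError_succ]
  congr 6
  push_cast
  ring

/-! ### Products of normal laws -/

lemma pi_gaussianReal_eq_withDensity (n : ℕ) :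
    Measure.pi (fun _ : Fin n => gaussianReal 0 1) =
      (volume : Measure (Fin n → ℝ)).withDensity
        fun x => ENNReal.ofReal (∏ i, normalPdf (x i)) := by
  refine Measure.pi_eq fun s hs => ?_
  have hi : Integrable (fun x : Fin n → ℝ => ∏ i, normalPdf (x i)) :=
    Integrable.fintype_prod fun _ => integrable_normalPdf
  rw [withDensity_apply _ (MeasurableSet.univ_pi hs),
    ← ofReal_integral_eq_lintegral_ofReal hi.integrableOn
      (Eventually.of_forall fun x => Finset.prod_nonneg fun i _ => (normalPdf_pos _).le),
    volume_pi, Measure.restrict_pi_pi, integral_fintype_prod_eq_prod,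
    ENNReal.ofReal_prod_of_nonneg fun i _ => integral_nonneg fun x => (normalPdf_pos x).le]
  exact Finset.prod_congr rfl fun i _ =>
    (gaussianReal_apply_eq_integral 0 one_ne_zero (s i)).symm

lemma measurableEmbedding_normalCdf : MeasurableEmbedding normalCdf :=
  continuous_normalCdf.measurableEmbedding strictMono_normalCdf.injective

lemma measurable_normalQuantile : Measurable normalQuantile := by
  -- Off (0,1) the infimum is over all of ℝ or over the empty set and has the default value 0 in
  -- both cases.
  have h : normalQuantile = Function.extend normalCdf id 0 := by
    ext u
    by_cases hu : u ∈ Ioo (0 : ℝ) 1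
    · obtain ⟨x, rfl⟩ := exists_normalCdf_eq hu
      rw [normalQuantile_normalCdf, strictMono_normalCdf.injective.extend_apply, id]
    · rw [Function.extend_apply' _ _ _ fun ⟨x, hx⟩ => hu (hx ▸ normalCdf_mem_Ioo x), Pi.zero_apply,
        normalQuantile]
      rcases le_or_gt u 0 with h0 | h0
      · have : {x : ℝ | u ≤ cdf (gaussianReal 0 1) x} = univ :=
          eq_univ_of_forall fun x => h0.trans (cdf_nonneg _ x)
        rw [this, Real.sInf_univ]
      · have h1 : 1 ≤ u := by
          by_contra hc
          exact hu ⟨h0, not_le.1 hc⟩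
        have : {x : ℝ | u ≤ cdf (gaussianReal 0 1) x} = ∅ :=
          eq_empty_of_forall_notMem fun x hx =>
            absurd (h1.trans hx) (not_le.2 (normalCdf_mem_Ioo x).2)
        rw [this, Real.sInf_empty]
  rw [h]
  exact measurableEmbedding_normalCdf.measurable_extend measurable_id measurable_zero

lemma gaussianReal_map_normalCdf :
    (gaussianReal 0 1).map normalCdf = (volume : Measure ℝ).restrict (Ioo 0 1) := by
  have h1 : IsProbabilityMeasure ((gaussianReal 0 1).map normalCdf) :=
    Measure.isProbabilityMeasure_map continuous_normalCdf.aemeasurable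
  have h2 : IsProbabilityMeasure ((volume : Measure ℝ).restrict (Ioo 0 1)) :=
    ⟨by simp⟩
  refine Measure.eq_of_cdf _ _ ?_
  ext u
  rw [cdf_eq_real, cdf_eq_real, measureReal_def, measureReal_def,
    Measure.map_apply continuous_normalCdf.measurable measurableSet_Iic,
    Measure.restrict_apply measurableSet_Iic]
  congr 1
  rcases le_or_gt u 0 with h0 | h0
  · have e1 : normalCdf ⁻¹' Iic u = ∅ :=
      eq_empty_of_forall_notMem fun x hx =>
        absurd ((normalCdf_mem_Ioo x).1.trans_le (hx.trans h0)) (lt_irrefl _)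
    have e2 : Iic u ∩ Ioo (0 : ℝ) 1 = ∅ :=
      eq_empty_of_forall_notMem fun x hx => absurd (hx.2.1.trans_le (hx.1.trans h0)) (lt_irrefl _)
    rw [e1, e2]
    simp
  · rcases lt_or_ge u 1 with hu | hu
    · obtain ⟨x, rfl⟩ := exists_normalCdf_eq ⟨h0, hu⟩
      have e1 : normalCdf ⁻¹' Iic (normalCdf x) = Iic x := by
        ext y
        exact strictMono_normalCdf.le_iff_le
      have e2 : Iic (normalCdf x) ∩ Ioo (0 : ℝ) 1 = Ioc 0 (normalCdf x) := by
        ext y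
        simp only [mem_inter_iff, mem_Iic, mem_Ioo, mem_Ioc]
        constructor
        · rintro ⟨a, b, c⟩; exact ⟨b, a⟩
        · rintro ⟨a, b⟩; exact ⟨b, a, b.trans_lt hu⟩
      rw [e1, e2, Real.volume_Ioc, sub_zero, normalCdf, ofReal_cdf]
    · have e1 : normalCdf ⁻¹' Iic u = univ :=
        eq_univ_of_forall fun x => (normalCdf_mem_Ioo x).2.le.trans hu
      have e2 : Iic u ∩ Ioo (0 : ℝ) 1 = Ioo 0 1 :=
        inter_eq_right.2 fun x hx => hx.2.le.trans hu
      rw [e1, e2]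
      simp

lemma pi_gaussianReal_map_normalCdf (n : ℕ) :
    (Measure.pi (fun _ : Fin n => gaussianReal 0 1)).map (fun x i => normalCdf (x i)) =
      (volume : Measure (Fin n → ℝ)).restrict (univ.pi fun _ => Ioo 0 1) := by
  have h : IsProbabilityMeasure ((gaussianReal 0 1).map normalCdf) :=
    Measure.isProbabilityMeasure_map continuous_normalCdf.aemeasurable
  rw [volume_pi, Measure.restrict_pi_pi, Measure.pi_map_pi
    fun _ => continuous_normalCdf.aemeasurable, gaussianReal_map_normalCdf]

/-! ### The prediction errors as a linear transformation -/

/-- The lower triangular matrix mapping `x_a, …, x_{a+n-1}` to the prediction errors of increasing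
orders. -/
def predMatrix (α : ℕ → ℝ) (n : ℕ) : Matrix (Fin n) (Fin n) ℝ :=
  Matrix.of fun i l => (predPoly α i.val).coeff ((i.val : ℤ) - l.val)

lemma predMatrix_mulVec (n : ℕ) (x : ℤ → ℝ) (a : ℤ) (i : Fin n) :
    (predMatrix α n).mulVec (fun l => x (a + l.val)) i = predError α i.val x (a + i.val) := by
  rw [predError_eq_sum α i.val n i.isLt]
  rfl

lemma det_predMatrix (n : ℕ) :
    (predMatrix α n).det = ∏ i : Fin n, (predPoly α i.val).coeff 0 := by
  rw [Matrix.det_of_isLowerTriangular]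
  · simp [predMatrix]
  · intro i j hij
    have : i < j := hij
    refine coeff_predPoly_eq_zero α _ _ (Or.inl ?_)
    have := Fin.lt_def.1 this
    omega

lemma det_predMatrix_pos (hα : ∀ k, 1 ≤ k → |α k| < 1) (n : ℕ) : 0 < (predMatrix α n).det := by
  rw [det_predMatrix]
  exact Finset.prod_pos fun i _ => coeff_predPoly_zero_pos hα i.val

lemma svineDensity_mul_prod_normalPdf (hα : ∀ k, 1 ≤ k → |α k| < 1) (n : ℕ) (x : Fin n → ℝ) :
    svineDensity (fun k => gaussianCopula (α k)) n (fun i => normalCdf (x i)) *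
        ∏ i, normalPdf (x i) =
      (predMatrix α n).det * ∏ i, normalPdf ((predMatrix α n).mulVec x i) := by
  -- An extension to all integers; the errors involved only see positions 0, …, n - 1.
  set z : ℤ → ℝ := fun j => if h : j.toNat < n then x ⟨j.toNat, h⟩ else 0 with hz
  have hx : x = fun i : Fin n => z i.val := by
    ext i
    simp [hz]
  have hmul : ∀ i, (predMatrix α n).mulVec x i = predError α i.val z i.val := by
    intro i
    have := predMatrix_mulVec (α := α) n z 0 i
    simp only [zero_add] at this
    rw [← this, ← hx]
  simp only [hmul]
  have hd := svineDensity_gaussian hα n z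
  have h1 : (fun i => normalCdf (x i)) = fun i : Fin n => normalCdf (z i.val) := by
    rw [hx]
  rw [h1, hd, det_predMatrix, ← Finset.prod_mul_distrib, ← Finset.prod_mul_distrib]
  refine Finset.prod_congr rfl fun i _ => ?_
  have h2 : x i = z i.val := congrFun hx i
  have h3 := (normalPdf_pos (z i.val)).ne'
  rw [h2]
  field_simp

/-- Under the s-vine law, the prediction errors of increasing orders are independent standard
normal. -/
theorem map_predMatrix_svine (hα : ∀ k, 1 ≤ k → |α k| < 1) (n : ℕ) :
    (((volume : Measure (Fin n → ℝ)).restrict (univ.pi fun _ => Ioo 0 1)).withDensity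
      fun u => ENNReal.ofReal (svineDensity (fun k => gaussianCopula (α k)) n u)).map
        (fun u => (predMatrix α n).mulVec fun i => normalQuantile (u i)) =
      Measure.pi fun _ : Fin n => gaussianReal 0 1 := by
  have hΦ : MeasurableEmbedding fun (x : Fin n → ℝ) i => normalCdf (x i) := by
    refine Continuous.measurableEmbedding ?_ fun x y hxy => ?_
    · exact continuous_pi fun i => continuous_normalCdf.comp (continuous_apply i)
    · exact funext fun i => strictMono_normalCdf.injective (congrFun hxy i)
  have hM : Measurable fun x : Fin n → ℝ => (predMatrix α n).mulVec x :=
    (Continuous.matrix_mulVec continuous_const continuous_id).measurable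
  have hQ : Measurable fun u : Fin n → ℝ => (predMatrix α n).mulVec fun i => normalQuantile (u i) :=
    hM.comp (measurable_pi_lambda _ fun i => measurable_normalQuantile.comp (measurable_pi_apply i))
  have hdet := det_predMatrix_pos hα n
  have hφ : Measurable fun x : Fin n → ℝ => ENNReal.ofReal (∏ i, normalPdf (x i)) :=
    (continuous_finsetProd _ fun i _ =>
      continuous_normalPdf.comp (continuous_apply i)).measurable.ennreal_ofReal
  ext s hs
  -- The uniform law on the cube is the image of the normal product law, so the integral is pulled
  -- back to normal scale. There the total density is det M ∏ φ((Mx)_i), and the determinant cancels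
  -- against the scaling of Lebesgue measure under M.
  rw [Measure.map_apply hQ hs, withDensity_apply _ (hQ hs), ← pi_gaussianReal_map_normalCdf,
    hΦ.restrict_map, hΦ.lintegral_map]
  have hpre : (fun (x : Fin n → ℝ) i => normalCdf (x i)) ⁻¹'
      ((fun u : Fin n → ℝ => (predMatrix α n).mulVec fun i => normalQuantile (u i)) ⁻¹' s) =
      (fun x : Fin n → ℝ => (predMatrix α n).mulVec x) ⁻¹' s := by
    ext x
    simp only [mem_preimage, normalQuantile_normalCdf]
  -- This form needs measurability of the normal density only, not of the s-vine density.
  rw [hpre, pi_gaussianReal_eq_withDensity, restrict_withDensity (hM hs),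
    lintegral_withDensity_eq_lintegral_mul_non_measurable _ hφ (by simp)]
  have hmul : ∀ x : Fin n → ℝ, ((fun x : Fin n → ℝ => ENNReal.ofReal (∏ i, normalPdf (x i))) *
      fun x : Fin n → ℝ => ENNReal.ofReal (svineDensity (fun k => gaussianCopula (α k)) n
        fun i => normalCdf (x i))) x = ENNReal.ofReal (predMatrix α n).det *
          ENNReal.ofReal (∏ i, normalPdf ((predMatrix α n).mulVec x i)) := by
    intro x
    rw [Pi.mul_apply, ← ENNReal.ofReal_mul (Finset.prod_nonneg fun i _ => (normalPdf_pos _).le),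
      mul_comm, svineDensity_mul_prod_normalPdf hα, ENNReal.ofReal_mul hdet.le]
  simp only [hmul]
  have hφM : Measurable fun x : Fin n → ℝ =>
    ENNReal.ofReal (∏ i, normalPdf ((predMatrix α n).mulVec x i)) := hφ.comp hM
  have hvol : (volume : Measure (Fin n → ℝ)).map (fun x => (predMatrix α n).mulVec x) =
      ENNReal.ofReal (predMatrix α n).det⁻¹ • volume := by
    have := Real.map_matrix_volume_pi_eq_smul_volume_pi hdet.ne'
    rwa [abs_of_pos (inv_pos.2 hdet)] at this
  rw [lintegral_const_mul _ hφM, withDensity_apply _ hs,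
    ← setLIntegral_map hs hφ hM, hvol, Measure.restrict_smul, lintegral_smul_measure, smul_eq_mul,
    ← mul_assoc, ← ENNReal.ofReal_mul hdet.le, mul_inv_cancel₀ hdet.ne', ENNReal.ofReal_one,
    one_mul]

end

/-! ### Moments of linear combinations -/

lemma pairing_T_mul_mul_invert (γ : ℤ → ℝ) (n : ℤ) (f g : ℝ[T;T⁻¹]) :
    pairing γ (T n * (f * invert g)) =
      pairing (fun j => pairing (fun i => γ (n + i - j)) f) g := by
  induction g using LaurentPolynomial.induction_on' with
  | add p q hp hq => rw [map_add, mul_add, mul_add, map_add, map_add, hp, hq]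
  | C_mul_T m a =>
    have e : T n * (f * invert (C a * T m)) = C a * (T (n - m) * f) := by
      rw [map_mul, invert_C, invert_T, sub_eq_add_neg, T_add]
      ring
    rw [e, pairing_C_mul, pairing_C_mul, pairing_T, pairing_T_mul]
    congr 3
    ext i
    congr 1
    ring

section Moments

variable {Ω : Type*} [MeasurableSpace Ω] {μ : Measure Ω}

lemma integral_pairing_mul {Y : ℤ → Ω → ℝ} {W : Ω → ℝ}
    (h : ∀ j, Integrable (fun ω => Y j ω * W ω) μ) (f : ℝ[T;T⁻¹]) :
    ∫ ω, pairing (fun j => Y j ω) f * W ω ∂μ = pairing (fun j => ∫ ω, Y j ω * W ω ∂μ) f := by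
  simp only [pairing_apply, Finset.sum_mul, mul_assoc]
  rw [integral_finsetSum _ fun j _ => (h j).const_mul _]
  exact Finset.sum_congr rfl fun j _ => integral_const_mul _ _

lemma memLp_pairing {Y : ℤ → Ω → ℝ} {p : ENNReal} (h : ∀ j, MemLp (Y j) p μ) (f : ℝ[T;T⁻¹]) :
    MemLp (fun ω => pairing (fun j => Y j ω) f) p μ := by
  simp only [pairing_apply]
  exact memLp_finsetSum _ fun j _ => (h j).const_mul _

/-- The dictionary between probability and algebra: the covariance of two filtered series is γ
paired with the shifted product of one filter and the reflection of the other. -/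
lemma integral_pairing_mul_pairing {X : ℤ → Ω → ℝ} {γ : ℤ → ℝ} (hX : ∀ t, MemLp (X t) 2 μ)
    (hγ : ∀ s t, ∫ ω, X s ω * X t ω ∂μ = γ (t - s)) (f g : ℝ[T;T⁻¹]) (s t : ℤ) :
    ∫ ω, pairing (fun j => X (s - j) ω) f * pairing (fun j => X (t - j) ω) g ∂μ =
      pairing γ (T (t - s) * (f * invert g)) := by
  have h1 : ∀ j, Integrable
      (fun ω => X (t - j) ω * pairing (fun j => X (s - j) ω) f) μ := fun j =>
    (hX (t - j)).integrable_mul (memLp_pairing (fun j => hX (s - j)) f)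
  have h2 : ∀ t i, Integrable (fun ω => X (s - i) ω * X t ω) μ := fun t i =>
    (hX (s - i)).integrable_mul (hX t)
  have h3 : ∀ j, ∫ ω, X (t - j) ω * pairing (fun j => X (s - j) ω) f ∂μ =
      pairing (fun i => γ (t - s + i - j)) f := fun j => by
    simp only [mul_comm (X (t - j) _)]
    rw [integral_pairing_mul (h2 (t - j))]
    congr 2
    ext i
    rw [hγ]
    congr 1
    ring
  simp only [mul_comm (pairing (fun j => X (s - j) _) f)]
  rw [integral_pairing_mul h1, pairing_T_mul_mul_invert]
  congr 2
  exact funext h3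

lemma integral_abs_pairing_le {Y : ℤ → Ω → ℝ} {b : ℝ} (h : ∀ j, Integrable (Y j) μ)
    (hb : ∀ j, ∫ ω, |Y j ω| ∂μ ≤ b) (f : ℝ[T;T⁻¹]) :
    ∫ ω, |pairing (fun j => Y j ω) f| ∂μ ≤ coeffNorm f * b := by
  have hi : Integrable (fun ω => ∑ j ∈ f.coeff.support, |f.coeff j| * |Y j ω|) μ :=
    integrable_finsetSum _ fun j _ => (h j).abs.const_mul _
  calc ∫ ω, |pairing (fun j => Y j ω) f| ∂μ
      ≤ ∫ ω, ∑ j ∈ f.coeff.support, |f.coeff j| * |Y j ω| ∂μ := by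
        refine integral_mono_of_nonneg (Eventually.of_forall fun ω => abs_nonneg _) hi
          (Eventually.of_forall fun ω => ?_)
        simp only [pairing_apply]
        exact (Finset.abs_sum_le_sum_abs _ _).trans_eq
          (Finset.sum_congr rfl fun j _ => abs_mul _ _)
    _ = ∑ j ∈ f.coeff.support, |f.coeff j| * ∫ ω, |Y j ω| ∂μ := by
        rw [integral_finsetSum _ fun j _ => (h j).abs.const_mul _]
        exact Finset.sum_congr rfl fun j _ => integral_const_mul _ _
    _ ≤ _ := by
        rw [coeffNorm, Finset.sum_mul]
        exact Finset.sum_le_sum fun j _ => mul_le_mul_of_nonneg_left (hb j) (abs_nonneg _)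

lemma ae_summable_abs {ι : Type*} [Countable ι] {f : ι → Ω → ℝ} {c : ι → ℝ}
    (hf : ∀ i, Integrable (f i) μ) (hc : ∀ i, ∫ ω, |f i ω| ∂μ ≤ c i) (hs : Summable c) :
    ∀ᵐ ω ∂μ, Summable fun i => |f i ω| := by
  have h : ∑' i, eLpNorm (f i) 1 μ ≠ ⊤ := by
    refine ne_top_of_le_ne_top hs.tsum_ofReal_ne_top (ENNReal.tsum_le_tsum fun i => ?_)
    rw [eLpNorm_one_eq_lintegral_enorm, ← ofReal_integral_norm_eq_lintegral_enorm (hf i)]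
    exact ENNReal.ofReal_le_ofReal (hc i)
  filter_upwards [summable_norm_of_tsum_eLpNorm_ne_top le_rfl
    (fun i => (hf i).aestronglyMeasurable) h] with ω hω
  simpa only [Real.norm_eq_abs] using hω

/-- An almost sure limit of random vectors with a common law has that law. -/
lemma map_eq_of_ae_tendsto [IsProbabilityMeasure μ] {E : Type*} [TopologicalSpace E]
    [MeasurableSpace E] [BorelSpace E] [HasOuterApproxClosed E] {ν : Measure E}
    {V : ℕ → Ω → E} {W : Ω → E} (hV : ∀ n, Measurable (V n)) (hW : Measurable W)
    (hlaw : ∀ n, μ.map (V n) = ν) (h : ∀ᵐ ω ∂μ, Tendsto (fun n => V n ω) atTop (𝓝 (W ω))) :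
    μ.map W = ν := by
  have h1 : IsProbabilityMeasure (μ.map W) := Measure.isProbabilityMeasure_map hW.aemeasurable
  have h2 : IsProbabilityMeasure ν := by
    rw [← hlaw 0]
    exact Measure.isProbabilityMeasure_map (hV 0).aemeasurable
  refine ext_of_forall_integral_eq_of_IsFiniteMeasure fun f => ?_
  have hfm : ∀ ρ : Measure E, AEStronglyMeasurable f ρ := fun ρ =>
    f.continuous.measurable.aestronglyMeasurable
  rw [integral_map hW.aemeasurable (hfm _)]
  have hlim : Tendsto (fun n => ∫ ω, f (V n ω) ∂μ) atTop (𝓝 (∫ ω, f (W ω) ∂μ)) := by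
    refine tendsto_integral_of_dominated_convergence (fun _ => ‖f‖)
      (fun n => (f.continuous.measurable.comp (hV n)).aestronglyMeasurable) (integrable_const _)
      (fun n => Eventually.of_forall fun ω => f.norm_coe_le_norm _) ?_
    filter_upwards [h] with ω hω using (f.continuous.tendsto _).comp hω
  have hconst : ∀ n, ∫ ω, f (V n ω) ∂μ = ∫ x, f x ∂ν := fun n => by
    rw [← hlaw n, integral_map (hV n).aemeasurable (hfm _)]
  simp only [hconst] at hlim
  exact (tendsto_nhds_unique hlim tendsto_const_nhds)

end Moments

/-! ### The prediction errors of a Gaussian s-vine process -/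

section NormalScale

variable {Ω : Type*} [MeasurableSpace Ω] {μ : Measure Ω}
  {α : ℕ → ℝ} {U : ℤ → Ω → ℝ}

/-- The process transformed to standard normal margins. -/
def toNormal (U : ℤ → Ω → ℝ) (t : ℤ) (ω : Ω) : ℝ := normalQuantile (U t ω)

/-- The prediction error of order `k` of the process in Gaussian scale. -/
def normalError (α : ℕ → ℝ) (U : ℤ → Ω → ℝ) (k : ℕ) (t : ℤ) (ω : Ω) : ℝ :=
  predError α k (fun s => toNormal U s ω) t

lemma measurable_toNormal (hU : ∀ t, Measurable (U t)) (t : ℤ) : Measurable (toNormal U t) :=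
  measurable_normalQuantile.comp (hU t)

lemma measurable_normalError (hU : ∀ t, Measurable (U t)) (k : ℕ) (t : ℤ) :
    Measurable (normalError α U k t) := by
  have : normalError α U k t = fun ω => ∑ j ∈ (predPoly α k).coeff.support,
      (predPoly α k).coeff j * toNormal U (t - j) ω := by
    ext ω
    rw [normalError, predError, pairing_apply]
  rw [this]
  exact Finset.measurable_sum _ fun j _ => (measurable_toNormal hU _).const_mul _

lemma map_normalError_eq_pi (hα : ∀ k, 1 ≤ k → |α k| < 1)
    (hU : IsSVineCopulaProcess (fun k => gaussianCopula (α k)) U μ) (a : ℤ) {n : ℕ} (hn : 2 ≤ n) :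
    μ.map (fun ω (i : Fin n) => normalError α U i.val (a + i.val) ω) =
      Measure.pi fun _ : Fin n => gaussianReal 0 1 := by
  have hM : Measurable fun x : Fin n → ℝ => (predMatrix α n).mulVec x :=
    (Continuous.matrix_mulVec continuous_const continuous_id).measurable
  have hQ : Measurable fun u : Fin n → ℝ => (predMatrix α n).mulVec fun i => normalQuantile (u i) :=
    hM.comp (measurable_pi_lambda _ fun i => measurable_normalQuantile.comp (measurable_pi_apply i))
  rw [← map_predMatrix_svine hα n, ← hU.density a n hn,
    Measure.map_map hQ (measurable_pi_lambda _ fun i => hU.measurable _)]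
  congr 1
  ext ω i
  exact (predMatrix_mulVec n (fun s => toNormal U s ω) a i).symm

lemma memLp_of_map_eq_gaussianReal {Y : Ω → ℝ} (hm : Measurable Y)
    (h : μ.map Y = gaussianReal 0 1) : MemLp Y 2 μ := by
  have h1 : MemLp id 2 (μ.map Y) := by
    rw [h]
    exact memLp_id_gaussianReal 2
  exact (memLp_map_measure_iff measurable_id.aestronglyMeasurable hm.aemeasurable).1 h1

lemma integral_of_map_eq_gaussianReal {Y : Ω → ℝ} (hm : Measurable Y)
    (h : μ.map Y = gaussianReal 0 1) : ∫ ω, Y ω ∂μ = 0 := by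
  have := integral_map (μ := μ) hm.aemeasurable (f := fun x : ℝ => x)
    measurable_id.aestronglyMeasurable
  rw [← this, h, integral_id_gaussianReal]

lemma integral_sq_of_map_eq_gaussianReal {Y : Ω → ℝ} (hm : Measurable Y)
    (h : μ.map Y = gaussianReal 0 1) : ∫ ω, Y ω * Y ω ∂μ = 1 := by
  have h1 := integral_map (μ := μ) hm.aemeasurable (f := fun x : ℝ => x * x)
    (by fun_prop)
  have h2 := variance_id_gaussianReal (μ := 0) (v := 1)
  rw [variance_eq_sub (memLp_id_gaussianReal 2)] at h2
  rw [← h1, h]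
  simpa [← pow_two] using h2

lemma integral_toNormal_mul
    (hU : IsSVineCopulaProcess (fun k => gaussianCopula (α k)) U μ) (s t : ℤ) :
    ∫ ω, toNormal U s ω * toNormal U t ω ∂μ =
      ∫ ω, toNormal U 0 ω * toNormal U (t - s) ω ∂μ := by
  have h := (hU.stationary s).comp
    (u := fun x : ℤ → ℝ => normalQuantile (x 0) * normalQuantile (x (t - s)))
    ((measurable_normalQuantile.comp (measurable_pi_apply _)).mul
      (measurable_normalQuantile.comp (measurable_pi_apply _)))
  have h1 := h.integral_eq
  simpa [Function.comp_def, toNormal] using h1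

lemma map_normalError (hα : ∀ k, 1 ≤ k → |α k| < 1)
    (hU : IsSVineCopulaProcess (fun k => gaussianCopula (α k)) U μ) (k : ℕ) (t : ℤ) :
    μ.map (normalError α U k t) = gaussianReal 0 1 := by
  -- Length k + 2 rather than k + 1, because the density is prescribed only from length 2 on.
  have h := map_normalError_eq_pi hα hU (t - k) (n := k + 2) (by omega)
  have h1 := congrArg (Measure.map (Function.eval (⟨k, by omega⟩ : Fin (k + 2)))) h
  rw [Measure.map_map (measurable_pi_apply _)
    (measurable_pi_lambda _ fun i => measurable_normalError hU.measurable _ _),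
    Measure.pi_map_eval] at h1
  simp only [measure_univ, Finset.prod_const_one, one_smul] at h1
  rw [← h1]
  congr 1
  ext ω
  simp

lemma map_toNormal (hα : ∀ k, 1 ≤ k → |α k| < 1)
    (hU : IsSVineCopulaProcess (fun k => gaussianCopula (α k)) U μ) (t : ℤ) :
    μ.map (toNormal U t) = gaussianReal 0 1 := by
  rw [← map_normalError hα hU 0 t]
  congr 1
  ext ω
  rw [normalError, predError_zero]

lemma abs_integral_toNormal_mul_le (hα : ∀ k, 1 ≤ k → |α k| < 1)
    (hU : IsSVineCopulaProcess (fun k => gaussianCopula (α k)) U μ) (s t : ℤ) :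
    |∫ ω, toNormal U s ω * toNormal U t ω ∂μ| ≤ 1 := by
  have hm := measurable_toNormal hU.measurable
  have h2 : ∀ t, MemLp (toNormal U t) 2 μ := fun t =>
    memLp_of_map_eq_gaussianReal (hm t) (map_toNormal hα hU t)
  have h1 : ∀ t, ∫ ω, toNormal U t ω * toNormal U t ω ∂μ = 1 := fun t =>
    integral_sq_of_map_eq_gaussianReal (hm t) (map_toNormal hα hU t)
  have hi : ∀ s t, Integrable (fun ω => toNormal U s ω * toNormal U t ω) μ := fun s t =>
    (h2 s).integrable_mul (h2 t)
  have hb : ∫ ω, |toNormal U s ω * toNormal U t ω| ∂μ ≤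
      ∫ ω, (2⁻¹ * (toNormal U s ω * toNormal U s ω) +
        2⁻¹ * (toNormal U t ω * toNormal U t ω)) ∂μ := by
    refine integral_mono (hi s t).abs (((hi s s).const_mul _).add ((hi t t).const_mul _))
      fun ω => ?_
    simp only
    rw [abs_le]
    constructor <;> nlinarith [sq_nonneg (toNormal U s ω - toNormal U t ω),
      sq_nonneg (toNormal U s ω + toNormal U t ω)]
  rw [integral_add ((hi s s).const_mul _) ((hi t t).const_mul _), integral_const_mul,
    integral_const_mul, h1, h1] at hb
  refine (abs_integral_le_integral_abs).trans (hb.trans ?_)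
  norm_num

variable [IsProbabilityMeasure μ]

lemma iIndepFun_normalError (hα : ∀ k, 1 ≤ k → |α k| < 1)
    (hU : IsSVineCopulaProcess (fun k => gaussianCopula (α k)) U μ) (a : ℤ) :
    iIndepFun (fun i : ℕ => normalError α U i (a + i)) μ := by
  rw [iIndepFun_iff_finset]
  intro s
  obtain ⟨n, hn⟩ := s.exists_nat_subset_range
  have h : iIndepFun (fun i : Fin (n + 2) => normalError α U i.val (a + i.val)) μ := by
    rw [iIndepFun_iff_map_fun_eq_pi_map
      fun i => (measurable_normalError hU.measurable _ _).aemeasurable,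
      map_normalError_eq_pi hα hU a (by omega)]
    simp only [map_normalError hα hU]
  have hlt : ∀ i : s, i.val < n + 2 := fun i => by
    have := Finset.mem_range.1 (hn i.property)
    omega
  have hinj : Function.Injective fun i : s => (⟨i.val, hlt i⟩ : Fin (n + 2)) := fun i j hij =>
    Subtype.ext (Fin.mk.inj hij)
  exact h.precomp (g := fun i : s => (⟨i.val, hlt i⟩ : Fin (n + 2))) hinj

lemma integral_abs_toNormal_le (hα : ∀ k, 1 ≤ k → |α k| < 1)
    (hU : IsSVineCopulaProcess (fun k => gaussianCopula (α k)) U μ) (t : ℤ) :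
    ∫ ω, |toNormal U t ω| ∂μ ≤ 1 := by
  have hm := measurable_toNormal hU.measurable t
  have h2 := memLp_of_map_eq_gaussianReal hm (map_toNormal hα hU t)
  have h1 := integral_sq_of_map_eq_gaussianReal hm (map_toNormal hα hU t)
  have hi : Integrable (fun ω => toNormal U t ω * toNormal U t ω) μ := h2.integrable_mul h2
  have hb : ∫ ω, |toNormal U t ω| ∂μ ≤
      ∫ ω, (2⁻¹ + 2⁻¹ * (toNormal U t ω * toNormal U t ω)) ∂μ := by
    refine integral_mono (h2.integrable (by norm_num)).abs
      ((integrable_const _).add (hi.const_mul _)) fun ω => ?_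
    simp only
    rw [abs_le]
    constructor <;> nlinarith [sq_nonneg (toNormal U t ω - 1), sq_nonneg (toNormal U t ω + 1)]
  rw [integral_add (integrable_const _) (hi.const_mul _), integral_const_mul, h1] at hb
  refine hb.trans ?_
  norm_num

/-- The autocovariance function of the process in Gaussian scale. -/
def autocov (U : ℤ → Ω → ℝ) (μ : Measure Ω) (j : ℤ) : ℝ :=
  ∫ ω, toNormal U 0 ω * toNormal U j ω ∂μ

/-- The two errors belong to windows that both start at time 0, so they are independent, centred and
of unit variance. -/
lemma pairing_autocov_predPoly (hα : ∀ k, 1 ≤ k → |α k| < 1)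
    (hU : IsSVineCopulaProcess (fun k => gaussianCopula (α k)) U μ) (i j : ℕ) :
    pairing (autocov U μ) (T ((j : ℤ) - i) * (predPoly α i * invert (predPoly α j))) =
      if i = j then 1 else 0 := by
  have hm := measurable_toNormal hU.measurable
  have h2 : ∀ t, MemLp (toNormal U t) 2 μ := fun t =>
    memLp_of_map_eq_gaussianReal (hm t) (map_toNormal hα hU t)
  have h := integral_pairing_mul_pairing h2 (γ := autocov U μ)
    (fun s t => integral_toNormal_mul hU s t) (predPoly α i) (predPoly α j) (0 + i) (0 + j)
  have e : ((0 + j : ℤ) - (0 + i)) = (j : ℤ) - i := by ring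
  rw [e] at h
  rw [← h]
  have hme := fun k t => measurable_normalError (α := α) hU.measurable k t
  split_ifs with hij
  · subst hij
    exact integral_sq_of_map_eq_gaussianReal (hme i (0 + i)) (map_normalError hα hU i _)
  · have h3 := ((iIndepFun_normalError hα hU 0).indepFun hij).integral_fun_mul_eq_mul_integral
      (hme i (0 + i)).aestronglyMeasurable (hme j (0 + j)).aestronglyMeasurable
    rw [integral_of_map_eq_gaussianReal (hme i (0 + i)) (map_normalError hα hU i _), zero_mul] at h3
    exact h3

end NormalScale

/-! ### Limits of prediction errors and the inverse of the triangular system -/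

lemma tendsto_limsup_of_summable_abs_sub {e : ℕ → ℝ} (h : Summable fun m => |e (m + 1) - e m|) :
    Tendsto e atTop (𝓝 (limsup e atTop)) ∧
      ∀ k, |limsup e atTop - e k| ≤ ∑' m, |e (m + 1) - e m| := by
  have hd : (fun m => dist (e m) (e m.succ)) = fun m => |e (m + 1) - e m| := by
    ext m
    rw [Real.dist_eq, abs_sub_comm]
  have hs : Summable fun m => dist (e m) (e m.succ) := by rwa [hd]
  obtain ⟨L, hL⟩ := cauchySeq_tendsto_of_complete (cauchySeq_of_summable_dist hs)
  rw [hL.limsup_eq]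
  refine ⟨hL, fun k => ?_⟩
  have h1 := dist_le_tsum_dist_of_tendsto hs hL k
  rw [Real.dist_eq, abs_sub_comm] at h1
  refine h1.trans ?_
  rw [← hd]
  -- The tail sum is enlarged to the full sum, a bound free of k that later serves for domination.
  exact tsum_comp_le_tsum_of_inj hs (fun _ => dist_nonneg) (add_right_injective k)

/-- The inverse of the matrix of prediction coefficients consists of inner products of the process
with its prediction errors. -/
def causalMatrix (α : ℕ → ℝ) (γ : ℤ → ℝ) (n : ℕ) : Matrix (Fin n) (Fin n) ℝ :=
  Matrix.of fun l i => pairing (fun x => γ (x + ((l.val : ℤ) - i.val))) (predPoly α i.val)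

/-- Applying the prediction filter of order r to the covariances with the error of order i gives the
covariance of two errors from windows with a common start, which is 1 or 0. -/
lemma predMatrix_mul_causalMatrix {α : ℕ → ℝ} {γ : ℤ → ℝ}
    (horth : ∀ i j : ℕ, pairing γ (T ((j : ℤ) - i) * (predPoly α i * invert (predPoly α j))) =
      if i = j then 1 else 0) (n : ℕ) : predMatrix α n * causalMatrix α γ n = 1 := by
  ext r i
  have h := horth i.val r.val
  rw [pairing_T_mul_mul_invert] at h
  have h1 := predError_eq_sum α r.val n r.isLt
    (fun s => pairing (fun x => γ (x + (s - i.val))) (predPoly α i.val)) 0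
  rw [Matrix.mul_apply, Matrix.one_apply]
  have h2 : (if i.val = r.val then (1 : ℝ) else 0) = if r = i then 1 else 0 := by
    congr 1
    simp [Fin.ext_iff, eq_comm]
  rw [← h2, ← h]
  simp only [zero_add] at h1
  refine h1.symm.trans ?_
  rw [predError]
  congr 2
  ext j
  congr 2
  ext x
  congr 1
  ring

lemma normalError_succ_sub {Ω : Type*} {α : ℕ → ℝ} {U : ℤ → Ω → ℝ} (k : ℕ) (t : ℤ) (ω : Ω) :
    normalError α U (k + 1) t ω - normalError α U k t ω =
      pairing (fun j => toNormal U (t - j) ω) (predPoly α (k + 1) - predPoly α k) := by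
  rw [normalError, normalError, predError, predError, map_sub]

/-- The limit of the prediction errors of increasing orders. -/
def innovation {Ω : Type*} (α : ℕ → ℝ) (U : ℤ → Ω → ℝ) (t : ℤ) (ω : Ω) : ℝ :=
  limsup (fun k => normalError α U k t ω) atTop

lemma tendsto_normalError {Ω : Type*} {α : ℕ → ℝ} {U : ℤ → Ω → ℝ} {t : ℤ} {ω : Ω}
    (h : Summable fun k => |normalError α U (k + 1) t ω - normalError α U k t ω|) :
    Tendsto (fun k => normalError α U k t ω) atTop (𝓝 (innovation α U t ω)) :=
  (tendsto_limsup_of_summable_abs_sub (e := fun k => normalError α U k t ω) h).1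

lemma abs_innovation_sub_normalError_le {Ω : Type*} {α : ℕ → ℝ} {U : ℤ → Ω → ℝ} {t : ℤ} {ω : Ω}
    (h : Summable fun k => |normalError α U (k + 1) t ω - normalError α U k t ω|) (k : ℕ) :
    |innovation α U t ω - normalError α U k t ω| ≤
      ∑' k, |normalError α U (k + 1) t ω - normalError α U k t ω| :=
  (tendsto_limsup_of_summable_abs_sub (e := fun k => normalError α U k t ω) h).2 k

/-! ### Almost sure convergence of the prediction errors -/

section NormalScale

variable {Ω : Type*} [MeasurableSpace Ω] {μ : Measure Ω} {α : ℕ → ℝ} {U : ℤ → Ω → ℝ}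

lemma measurable_innovation (hU : ∀ t, Measurable (U t)) (t : ℤ) :
    Measurable (innovation α U t) :=
  Measurable.limsup fun k => measurable_normalError hU k t

lemma ae_normalCdf_toNormal (hU : IsSVineCopulaProcess (fun k => gaussianCopula (α k)) U μ) :
    ∀ᵐ ω ∂μ, ∀ t, U t ω = normalCdf (toNormal U t ω) := by
  refine ae_all_iff.2 fun t => ?_
  have h : ∀ᵐ u ∂(μ.map (U t)), u ∈ Ioo (0 : ℝ) 1 := by
    rw [show μ.map (U t) = cond volume (Ioo 0 1) from hU.uniform t]
    exact ae_cond_mem measurableSet_Ioo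
  filter_upwards [ae_of_ae_map (hU.measurable t).aemeasurable h] with ω hω
  exact (normalCdf_normalQuantile hω).symm

variable [IsProbabilityMeasure μ]

lemma integrable_normalError_succ_sub (hα : ∀ k, 1 ≤ k → |α k| < 1)
    (hU : IsSVineCopulaProcess (fun k => gaussianCopula (α k)) U μ) (k : ℕ) (t : ℤ) :
    Integrable (fun ω => normalError α U (k + 1) t ω - normalError α U k t ω) μ := by
  have h : ∀ k, Integrable (normalError α U k t) μ := fun k =>
    (memLp_of_map_eq_gaussianReal (measurable_normalError hU.measurable k t)
      (map_normalError hα hU k t)).integrable (by norm_num)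
  exact (h _).sub (h _)

lemma integral_abs_normalError_succ_sub_le (hα : ∀ k, 1 ≤ k → |α k| < 1)
    (hU : IsSVineCopulaProcess (fun k => gaussianCopula (α k)) U μ) (k : ℕ) (t : ℤ) :
    ∫ ω, |normalError α U (k + 1) t ω - normalError α U k t ω| ∂μ ≤
      coeffNorm (predPoly α (k + 1) - predPoly α k) := by
  simp only [normalError_succ_sub]
  have h := integral_abs_pairing_le (Y := fun j => toNormal U (t - j)) (μ := μ) (b := 1)
    (fun j => (memLp_of_map_eq_gaussianReal (measurable_toNormal hU.measurable _)
      (map_toNormal hα hU _)).integrable (by norm_num))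
    (fun j => integral_abs_toNormal_le hα hU _) (predPoly α (k + 1) - predPoly α k)
  rwa [mul_one] at h

lemma ae_summable_abs_normalError_sub (hα : ∀ k, 1 ≤ k → |α k| < 1)
    (hsum : Summable fun k : ℕ => |α (k + 1)|)
    (hU : IsSVineCopulaProcess (fun k => gaussianCopula (α k)) U μ) (t : ℤ) :
    ∀ᵐ ω ∂μ, Summable fun k => |normalError α U (k + 1) t ω - normalError α U k t ω| :=
  ae_summable_abs (fun k => integrable_normalError_succ_sub hα hU k t)
    (fun k => integral_abs_normalError_succ_sub_le hα hU k t)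
    (summable_coeffNorm_predPoly_sub hα hsum)

/-- In expectation the double sum is at most the product of two convergent series. This supplies the
dominating sequence for causality. -/
lemma ae_summable_mul_tsum_abs_normalError_sub (hα : ∀ k, 1 ≤ k → |α k| < 1)
    (hsum : Summable fun k : ℕ => |α (k + 1)|)
    (hU : IsSVineCopulaProcess (fun k => gaussianCopula (α k)) U μ) {Ψ : ℕ → ℝ}
    (hΨ0 : ∀ j, 0 ≤ Ψ j) (hΨ : Summable Ψ) (t : ℤ) :
    ∀ᵐ ω ∂μ, Summable fun j : ℕ =>
      Ψ j * ∑' k, |normalError α U (k + 1) (t - j) ω - normalError α U k (t - j) ω| := by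
  have hc : Summable fun x : ℕ × ℕ =>
      Ψ x.1 * coeffNorm (predPoly α (x.2 + 1) - predPoly α x.2) :=
    Summable.mul_of_nonneg (f := Ψ) (g := fun k => coeffNorm (predPoly α (k + 1) - predPoly α k))
      hΨ (summable_coeffNorm_predPoly_sub hα hsum) hΨ0 fun _ => coeffNorm_nonneg _
  have h := ae_summable_abs (μ := μ)
    (f := fun (x : ℕ × ℕ) ω => Ψ x.1 * (normalError α U (x.2 + 1) (t - x.1) ω -
      normalError α U x.2 (t - x.1) ω))
    (fun x => (integrable_normalError_succ_sub hα hU x.2 _).const_mul _) (fun x => ?_) hc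
  · filter_upwards [h] with ω hω
    refine hω.prod.congr fun j => ?_
    rw [← tsum_mul_left]
    exact tsum_congr fun k => by rw [abs_mul, abs_of_nonneg (hΨ0 j)]
  · simp only [abs_mul, abs_of_nonneg (hΨ0 _)]
    rw [integral_const_mul]
    exact mul_le_mul_of_nonneg_left (integral_abs_normalError_succ_sub_le hα hU _ _) (hΨ0 _)

/-! ### The innovations -/

/-- The errors of order T + i at time a + i all have windows starting at a - T, so they are exactly
independent for each T. The law survives the almost sure limit T → ∞. -/
lemma map_innovation_eq_pi (hα : ∀ k, 1 ≤ k → |α k| < 1)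
    (hsum : Summable fun k : ℕ => |α (k + 1)|)
    (hU : IsSVineCopulaProcess (fun k => gaussianCopula (α k)) U μ) (a : ℤ) (n : ℕ) :
    μ.map (fun ω (i : Fin n) => innovation α U (a + i.val) ω) =
      Measure.pi fun _ : Fin n => gaussianReal 0 1 := by
  refine map_eq_of_ae_tendsto
    (V := fun T ω (i : Fin n) => normalError α U (T + i.val) (a + i.val) ω)
    (fun T => measurable_pi_lambda _ fun i => measurable_normalError hU.measurable _ _)
    (measurable_pi_lambda _ fun i => measurable_innovation hU.measurable _) (fun T => ?_) ?_
  · have hinj : Function.Injective fun i : Fin n => T + i.val := fun i j hij =>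
      Fin.ext (by simpa using hij)
    have h := (iIndepFun_normalError hα hU (a - T)).precomp hinj
    have e : ∀ i : Fin n, a - T + ((T + i.val : ℕ) : ℤ) = a + i.val := fun i => by
      push_cast; ring
    simp only [e] at h
    rw [(iIndepFun_iff_map_fun_eq_pi_map
      fun i => (measurable_normalError hU.measurable _ _).aemeasurable).1 h]
    simp only [map_normalError hα hU]
  · filter_upwards [ae_all_iff.2 fun i : Fin n =>
      ae_summable_abs_normalError_sub hα hsum hU (a + i.val)] with ω hω
    refine tendsto_pi_nhds.2 fun i => ?_
    exact (tendsto_normalError (hω i)).comp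
      (tendsto_add_atTop_nat i.val)

lemma map_innovation (hα : ∀ k, 1 ≤ k → |α k| < 1)
    (hsum : Summable fun k : ℕ => |α (k + 1)|)
    (hU : IsSVineCopulaProcess (fun k => gaussianCopula (α k)) U μ) (t : ℤ) :
    μ.map (innovation α U t) = gaussianReal 0 1 :=
  map_eq_of_ae_tendsto (fun k => measurable_normalError hU.measurable k t)
    (measurable_innovation hU.measurable t) (fun k => map_normalError hα hU k t)
    ((ae_summable_abs_normalError_sub hα hsum hU t).mono fun _ hω =>
      tendsto_normalError hω)

lemma iIndepFun_innovation (hα : ∀ k, 1 ≤ k → |α k| < 1)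
    (hsum : Summable fun k : ℕ => |α (k + 1)|)
    (hU : IsSVineCopulaProcess (fun k => gaussianCopula (α k)) U μ) :
    iIndepFun (innovation α U) μ := by
  rw [iIndepFun_iff_finset]
  intro s
  obtain ⟨a, ha⟩ := s.bddBelow
  obtain ⟨b, hb⟩ := s.bddAbove
  have h : iIndepFun (fun i : Fin (b - a + 1).toNat => innovation α U (a + i.val)) μ := by
    rw [iIndepFun_iff_map_fun_eq_pi_map
      fun i => (measurable_innovation hU.measurable _).aemeasurable,
      map_innovation_eq_pi hα hsum hU]
    simp only [map_innovation hα hsum hU]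
  have hmem : ∀ i : s, a ≤ i.val ∧ i.val ≤ b := fun i => ⟨ha i.property, hb i.property⟩
  have hlt : ∀ i : s, (i.val - a).toNat < (b - a + 1).toNat := fun i => by
    have := hmem i
    omega
  have hinj : Function.Injective
      fun i : s => (⟨(i.val - a).toNat, hlt i⟩ : Fin (b - a + 1).toNat) := fun i j hij => by
    have h1 := Fin.mk.inj hij
    have h2 := hmem i
    have h3 := hmem j
    exact Subtype.ext (by omega)
  have h4 := h.precomp hinj
  have e : ∀ i : s, a + (((i.val - a).toNat : ℕ) : ℤ) = i.val := fun i => by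
    have := hmem i
    omega
  simp only [e] at h4
  exact h4

lemma isIIDUniform_normalCdf_innovation (hα : ∀ k, 1 ≤ k → |α k| < 1)
    (hsum : Summable fun k : ℕ => |α (k + 1)|)
    (hU : IsSVineCopulaProcess (fun k => gaussianCopula (α k)) U μ) :
    IsIIDUniform (fun t ω => normalCdf (innovation α U t ω)) μ where
  measurable t := continuous_normalCdf.measurable.comp (measurable_innovation hU.measurable t)
  indep := (iIndepFun_innovation hα hsum hU).comp (fun _ => normalCdf)
    fun _ => continuous_normalCdf.measurable
  uniform t := by
    have h : μ.map (fun ω => normalCdf (innovation α U t ω)) =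
        (μ.map (innovation α U t)).map normalCdf :=
      (Measure.map_map continuous_normalCdf.measurable
        (measurable_innovation hU.measurable t)).symm
    rw [pdf.IsUniform, h, map_innovation hα hsum hU, gaussianReal_map_normalCdf,
      ProbabilityTheory.cond]
    simp

/-! ### Invertibility and causality -/

lemma hasInvertibleRepresentation_innovation (hα : ∀ k, 1 ≤ k → |α k| < 1)
    (hsum : Summable fun k : ℕ => |α (k + 1)|)
    (hU : IsSVineCopulaProcess (fun k => gaussianCopula (α k)) U μ) :
    HasInvertibleRepresentation (fun k => gaussianCopula (α k)) U
      (fun t ω => normalCdf (innovation α U t ω)) μ := by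
  intro t
  filter_upwards [ae_normalCdf_toNormal hU, ae_summable_abs_normalError_sub hα hsum hU t]
    with ω hω hs
  have h : ∀ k, rosenblatt (fun k => gaussianCopula (α k)) k (pastWindow U t k ω) (U t ω) =
      normalCdf (normalError α U k t ω) := fun k => by
    rw [normalError, ← (rosenblatt_gaussian hα k).1 (fun s => toNormal U s ω) t, ← hω t]
    congr 1
    ext i
    exact hω _
  simp only [h]
  exact (continuous_normalCdf.tendsto _).comp (tendsto_normalError hs)

lemma hasCausalRepresentation_innovation (hα : ∀ k, 1 ≤ k → |α k| < 1)
    (hsum : Summable fun k : ℕ => |α (k + 1)|)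
    (hU : IsSVineCopulaProcess (fun k => gaussianCopula (α k)) U μ) :
    HasCausalRepresentation (fun k => gaussianCopula (α k)) U
      (fun t ω => normalCdf (innovation α U t ω)) μ := by
  have horth := pairing_autocov_predPoly hα hU
  obtain ⟨Ψ, hΨ0, hΨs, hΨ⟩ := exists_summable_bound_pairing_predPoly hα hsum
    (fun j => abs_integral_toNormal_mul_le hα hU 0 j) horth
  intro t
  filter_upwards [ae_normalCdf_toNormal hU,
    ae_all_iff.2 fun t => ae_summable_abs_normalError_sub hα hsum hU t,
    ae_summable_mul_tsum_abs_normalError_sub hα hsum hU hΨ0 hΨs t] with ω hω hs hsΨ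
  set x : ℤ → ℝ := fun s => toNormal U s ω with hx
  set w : ℤ → ℝ := fun s => innovation α U s ω with hw
  set G : ∀ n, Matrix (Fin n) (Fin n) ℝ := causalMatrix α (autocov U μ) with hG
  have hMG : ∀ n, predMatrix α n * G n = 1 := predMatrix_mul_causalMatrix horth
  have hGM : ∀ n, G n * predMatrix α n = 1 := fun n => mul_eq_one_comm.1 (hMG n)
  -- the solution of the system with the limiting innovations on the window of length `k + 1`
  set v : ∀ k : ℕ, Fin (k + 1) → ℝ := fun k =>
    (G (k + 1)).mulVec fun i => w (t - k + i.val) with hv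
  have hS : ∀ k, rosenblattS (fun k => gaussianCopula (α k)) k
      (pastWindow (fun t ω => normalCdf (innovation α U t ω)) t k ω)
      (normalCdf (innovation α U t ω)) = normalCdf (v k (Fin.last k)) := by
    intro k
    set y : ℤ → ℝ := fun s =>
      if h : (s - (t - k)).toNat < k + 1 then v k ⟨(s - (t - k)).toNat, h⟩ else 0 with hy
    have hyv : (fun l : Fin (k + 1) => y (t - k + l.val)) = v k := by
      ext l
      have hl : (t - k + l.val - (t - k)).toNat = l.val := by omega
      simp only [hy, hl, l.isLt, dite_true]
    have h1 := rosenblattS_gaussian hα w y (t - k) k fun i hi => by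
      have h2 := predMatrix_mulVec (α := α) (k + 1) y (t - k) ⟨i, by omega⟩
      rw [hyv, hv, Matrix.mulVec_mulVec, hMG, Matrix.one_mulVec] at h2
      exact h2.symm
    rw [← congrFun hyv (Fin.last k), Fin.val_last, ← h1]
    congr 1
    simp [hw]
  -- Both terms are the last coordinate of `G (k + 1)` applied to a vector: the innovations for v,
  -- the errors of increasing order for x. Reversing the summation indexes by the lag j = k - i.
  have hdiff : ∀ k, v k (Fin.last k) - x t = ∑ j ∈ Finset.range (k + 1),
      pairing (fun i => autocov U μ (i + (j : ℤ))) (predPoly α (k - j)) *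
        (w (t - j) - normalError α U (k - j) (t - j) ω) := by
    intro k
    have h1 : x t = (G (k + 1)).mulVec (fun i => normalError α U i.val (t - k + i.val) ω)
        (Fin.last k) := by
      have h2 : (fun i : Fin (k + 1) => normalError α U i.val (t - k + i.val) ω) =
          (predMatrix α (k + 1)).mulVec fun l => x (t - k + l.val) :=
        funext fun i => (predMatrix_mulVec (k + 1) x (t - k) i).symm
      rw [h2, Matrix.mulVec_mulVec, hGM, Matrix.one_mulVec]
      simp
    rw [h1, hv, ← Finset.sum_range_reflect]
    have hGk : ∀ i, G (k + 1) (Fin.last k) i =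
        pairing (fun x => autocov U μ (x + ((k : ℤ) - i.val))) (predPoly α i.val) := fun _ => rfl
    simp only [Matrix.mulVec, dotProduct, ← Finset.sum_sub_distrib, ← mul_sub, hGk]
    rw [← Finset.sum_range fun i => pairing (fun x => autocov U μ (x + ((k : ℤ) - i)))
      (predPoly α i) * (w (t - k + i) - normalError α U i (t - k + i) ω)]
    refine Finset.sum_congr rfl fun i hi => ?_
    have hi' := Finset.mem_range.1 hi
    have e1 : k - (k + 1 - 1 - i) = i := by omega
    have e2 : (((k + 1 - 1 - i : ℕ) : ℤ)) = k - i := by omega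
    rw [e1, e2]
    have e3 : t - ((k : ℤ) - i) = t - k + i := by ring
    rw [e3]
  have hlim : Tendsto (fun k => v k (Fin.last k) - x t) atTop (𝓝 0) := by
    set F : ℕ → ℕ → ℝ := fun k j => if j ∈ Finset.range (k + 1) then
      pairing (fun i => autocov U μ (i + (j : ℤ))) (predPoly α (k - j)) *
        (w (t - j) - normalError α U (k - j) (t - j) ω) else 0 with hF
    have hFs : ∀ k, v k (Fin.last k) - x t = ∑' j, F k j := fun k => by
      rw [hdiff, tsum_eq_sum (s := Finset.range (k + 1)) fun j hj => if_neg hj]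
      exact Finset.sum_congr rfl fun j hj => (if_pos hj).symm
    simp only [hFs]
    have hbound : ∀ k j, ‖F k j‖ ≤ Ψ j * |w (t - j) - normalError α U (k - j) (t - j) ω| := by
      intro k j
      simp only [hF]
      split_ifs
      · rw [norm_mul, Real.norm_eq_abs, Real.norm_eq_abs]
        exact mul_le_mul_of_nonneg_right (hΨ _ _) (abs_nonneg _)
      · rw [norm_zero]
        exact mul_nonneg (hΨ0 j) (abs_nonneg _)
    -- At each fixed lag j the order k - j tends to infinity, so the term vanishes. It is dominated
    -- by Ψ j times the total variation over all orders of the errors at time t - j.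
    have h0 := tendsto_tsum_of_dominated_convergence (𝓕 := atTop) (f := F) (g := fun _ => 0) hsΨ
      (fun j => ?_) (Eventually.of_forall fun k j => (hbound k j).trans
        (mul_le_mul_of_nonneg_left
          (abs_innovation_sub_normalError_le (hs (t - j)) (k - j)) (hΨ0 j)))
    · simpa using h0
    · refine squeeze_zero_norm (fun k => hbound k j) ?_
      have h1 : Tendsto (fun k => normalError α U (k - j) (t - j) ω) atTop (𝓝 (w (t - j))) :=
        (tendsto_normalError (hs (t - j))).comp (tendsto_sub_atTop_nat j)
      have h2 := ((h1.const_sub (w (t - j))).abs).const_mul (Ψ j)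
      simpa using h2
  have hlim' : Tendsto (fun k => v k (Fin.last k)) atTop (𝓝 (x t)) := by
    simpa using hlim.add_const (x t)
  simp only [hS]
  rw [hω t]
  exact (continuous_normalCdf.tendsto _).comp hlim'

end NormalScale

end SVine

end

theorem mainTheorem1 {Ω : Type*} [MeasurableSpace Ω] (μ : Measure Ω) [IsProbabilityMeasure μ]
    (α : ℕ → ℝ) (hα : ∀ k, 1 ≤ k → |α k| < 1) (hsum : Summable fun k : ℕ => |α (k + 1)|)
    (U : ℤ → Ω → ℝ) (hU : SVine.IsSVineCopulaProcess (fun k => SVine.gaussianCopula (α k)) U μ) :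
    ∃ Z : ℤ → Ω → ℝ, SVine.IsIIDUniform Z μ ∧
      SVine.HasCausalRepresentation (fun k => SVine.gaussianCopula (α k)) U Z μ ∧
      SVine.HasInvertibleRepresentation (fun k => SVine.gaussianCopula (α k)) U Z μ := by
  exact ⟨fun t ω => SVine.normalCdf (SVine.innovation α U t ω),
    SVine.isIIDUniform_normalCdf_innovation hα hsum hU,
    SVine.hasCausalRepresentation_innovation hα hsum hU,
    SVine.hasInvertibleRepresentation_innovation hα hsum hU⟩
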